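/- Consider an $N$-player normal form game with player set $A=\{1,\dots,N\}$, finite strategy sets $S^i$, and payoff functions $G^i:\prod_{j\in A}S^j\to\mathbb R$, extended multilinearly to $\Delta=\prod_{i\in A}\Delta^i$, where $\Delta^i$ is the simplex of probability vectors on $S^i$. Let $X=\prod_{i\in A}\mathbb R^{S^i}$ and, for every $i\in A$, let $\sigma^i:\mathbb R^{S^i}\to\Delta^i$ be continuous with $\sigma^{is}(x^i)>0$ for all $s\in S^i$ and $x^i\in\mathbb R^{S^i}$. Fix $x_0\in X$ and numbers $\theta_0^{is}>0$. At each stage $n+1$ ($n\ge 0$), conditionally on the history $\mathcal F_n$ of the first $n$ stages, the players draw their strategies $s_{n+1}^i$ independently, player $i$ with law $\sigma^i(x_n^i)$; player $i$ gets the payoff $g_{n+1}^i=G^i(s_{n+1}^1,\dots,s_{n+1}^N)$, and the perceptions are updated by $$x_{n+1}^{is}=\Big(1-\frac1{\theta_n^{is}}\Big)x_n^{is}+\frac1{\theta_n^{is}}\,g_{n+1}^i\ \text{ if } s=s_{n+1}^i,\qquad x_{n+1}^{is}=x_n^{is}\ \text{ otherwise},$$ where $\theta_n^{is}=\theta_0^{is}+\#\{1\le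 m\le n:\ s_m^i=s\}$. Put $\lambda_n^{is}=\theta_n^{is}/(n+1)$ (the empirical frequencies of play). Consider the differential equation $$\dot x^{is}=\frac{\sigma^{is}(x^i)}{\lambda^{is}}\Big(G^i\big(s,\sigma^{-i}(x)\big)-x^{is}\Big),\qquad \dot\lambda^{is}=\sigma^{is}(x^i)-\lambda^{is}\qquad(i\in A,\ s\in S^i)\qquad(\ast)$$ on the set of all $(x,\lambda)\in X\times\Delta$ such that $\lambda^{is}>0$ for all $i,s$. A set $D$ is called internally chain transitive (ICT) for $(\ast)$ if it is compact and, for all $\varepsilon>0$, $T>0$ and $p,q\in D$, there are $k\ge1$, times $t_1,\dots,t_k>T$ and solutions $\mathbf z_j:[0,t_j]\to D$ of $(\ast)$, $1\le j\le k$, such that $\|\mathbf z_1(0)-p\|<\varepsilon$, $\|\mathbf z_j(t_j)-\mathbf z_{j+1}(0)\|<\varepsilon$ for $1\le j<k$, and $\|\mathbf z_k(t_k)-q\|<\varepsilon$. Then the process $(x_n,\lambda_n)_{n\ge 0}$ converges almost surely to an ICT set for $(\ast)$. More precisely, almost surely, the limit set $\mathcal L$ of $(x_n,\lambda_n)_n$,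 that is, the set of all limits of its convergent subsequences, is nonempty, is contained in $\{(x,\lambda)\in X\times\Delta:\ \lambda^{is}>0 \text{ for all } i,s\}$, is an ICT set for $(\ast)$, and the distance from $(x_n,\lambda_n)$ to $\mathcal L$ tends to $0$. -/

import Mathlib

open MeasureTheory Filter Topology

noncomputable section

namespace AdaptivePlay

/-! ## Ordinary differential equations, limit sets, internally chain transitive sets -/

section Dynamics

variable {E : Type*} [NormedAddCommGroup E] [NormedSpace ℝ E]

/-- `z` is a solution of `z' = H(z)` on the time interval `[0, t]`
(one-sided derivatives at the end points). -/
def IsSolutionOn (H : E → E) (t : ℝ) (z : ℝ → E) : Prop :=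
  ∀ s ∈ Set.Icc (0 : ℝ) t, HasDerivWithinAt z (H (z s)) (Set.Icc 0 t) s

/-- There is an `(ε, T)`-chain in `Z` from `x` to `y` for `z' = H(z)`. The chain consists of the
`k + 1` solutions `c 0, …, c k`, run for the times `t 0, …, t k`, so that it has at least
one link. -/
def HasChain (H : E → E) (Z : Set E) (ε T : ℝ) (x y : E) : Prop :=
  ∃ (k : ℕ) (c : ℕ → ℝ → E) (t : ℕ → ℝ),
    (∀ j ≤ k, T < t j ∧ IsSolutionOn H (t j) (c j) ∧ ∀ s ∈ Set.Icc (0 : ℝ) (t j), c j s ∈ Z) ∧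
    (∀ j < k, ‖c j (t j) - c (j + 1) 0‖ < ε) ∧
    ‖c 0 0 - x‖ < ε ∧ ‖c k (t k) - y‖ < ε

/-- `D` is internally chain transitive for `z' = H(z)`. -/
def IsICT (H : E → E) (D : Set E) : Prop :=
  IsCompact D ∧ ∀ ε > 0, ∀ T > 0, ∀ x ∈ D, ∀ y ∈ D, HasChain H D ε T x y

/-- The limit set of a sequence: all limits of `z (n l)` along some `n l → ∞`. -/
def limitSet (z : ℕ → E) : Set E :=
  {p | ∃ n : ℕ → ℕ, Tendsto n atTop atTop ∧ Tendsto (fun l => z (n l)) atTop (𝓝 p)}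

end Dynamics

/-! ## The game, the adjusted process and the continuous dynamics -/

section Game

variable {ι : Type*} [Fintype ι] [DecidableEq ι]
  {S : ι → Type*} [∀ i, Fintype (S i)] [∀ i, DecidableEq (S i)]

/-- The multilinear extension of a payoff function `u` to (mixed) profiles. -/
def mixedPayoff (u : (∀ j, S j) → ℝ) (π : ∀ j, S j → ℝ) : ℝ :=
  ∑ a : ∀ j, S j, (∏ j, π j (a j)) * u a

/-- `G^i(s, π^{-i})`: player `i` uses the pure strategy `s`, the opponents use `π`. -/
def deviationPayoff (G : ι → (∀ j, S j) → ℝ) (i : ι) (s : S i) (π : ∀ j, S j → ℝ) : ℝ :=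
  mixedPayoff (G i) (Function.update π i (Pi.single s 1))

/-- `θ_n^{is}`: the initial value `θ_0^{is}` plus the number of times player `i` used `s` in the
first `n` stages. Along a sequence of play `h`, the profile used in stage `n + 1` is `h n`. -/
def count (θ₀ : ∀ i, S i → ℝ) (h : ℕ → ∀ j, S j) (n : ℕ) (i : ι) (s : S i) : ℝ :=
  θ₀ i s + (((Finset.range n).filter fun m => h m i = s).card : ℝ)

/-- The perceptions `x_n^{is}` along a sequence of play `h`, started at `x₀`. -/
def perception (G : ι → (∀ j, S j) → ℝ) (x₀ θ₀ : ∀ i, S i → ℝ) (h : ℕ → ∀ j, S j) :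
    ℕ → ∀ i, S i → ℝ
  | 0 => x₀
  | n + 1 => fun i s =>
      if h n i = s then
        (1 - 1 / count θ₀ h n i s) * perception G x₀ θ₀ h n i s
          + 1 / count θ₀ h n i s * G i (h n)
      else perception G x₀ θ₀ h n i s

/-- The empirical frequencies `λ_n^{is} = θ_n^{is} / (n + 1)`. -/
def frequency (θ₀ : ∀ i, S i → ℝ) (h : ℕ → ∀ j, S j) (n : ℕ) : ∀ i, S i → ℝ :=
  fun i s => count θ₀ h n i s / ((n : ℝ) + 1)

/-- The process `(x_n, λ_n)` along a sequence of play `h`. -/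
def process (G : ι → (∀ j, S j) → ℝ) (x₀ θ₀ : ∀ i, S i → ℝ) (h : ℕ → ∀ j, S j) (n : ℕ) :
    (∀ i, S i → ℝ) × (∀ i, S i → ℝ) :=
  (perception G x₀ θ₀ h n, frequency θ₀ h n)

/-- The set of pairs `(x, λ)` with `λ` a mixed profile all of whose weights are positive: the part
of the phase space where the denominators in the vector field do not vanish. -/
def phaseSpace (S : ι → Type*) [∀ i, Fintype (S i)] :
    Set ((∀ i, S i → ℝ) × (∀ i, S i → ℝ)) :=
  {z | ∀ i, z.2 i ∈ stdSimplex ℝ (S i) ∧ ∀ s, 0 < z.2 i s}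

/-- The vector field `Ψ = (Ψ_x, Ψ_λ)` of the continuous dynamics; `Ψ_x` is meaningful where all
`λ^{is}` are positive. -/
def vectorField (G : ι → (∀ j, S j) → ℝ) (σ : ∀ i, (S i → ℝ) → (S i → ℝ))
    (z : (∀ i, S i → ℝ) × (∀ i, S i → ℝ)) : (∀ i, S i → ℝ) × (∀ i, S i → ℝ) :=
  (fun i s => σ i (z.1 i) s / z.2 i s
      * (deviationPayoff G i s (fun j => σ j (z.1 j)) - z.1 i s),
   fun i s => σ i (z.1 i) s - z.2 i s)

/-- The σ-algebra generated by the profiles played in the first `n` stages (the payoffs are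
functions of these profiles). -/
abbrev history {Ω : Type*} (a : ℕ → Ω → ∀ j, S j) (n : ℕ) : MeasurableSpace Ω :=
  ⨆ m, ⨆ _ : m < n, MeasurableSpace.comap (a m) ⊤

/-- The random profiles `a n`, played in stage `n + 1`, are generated by the decision rule `σ`:
given the first `n` stages, the players draw their strategies independently, player `i` with law
`σ^i(x_n^i)`. -/
structure IsPlay {Ω : Type*} [MeasurableSpace Ω] (μ : Measure Ω)
    (G : ι → (∀ j, S j) → ℝ) (σ : ∀ i, (S i → ℝ) → (S i → ℝ)) (x₀ θ₀ : ∀ i, S i → ℝ)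
    (a : ℕ → Ω → ∀ j, S j) : Prop where
  measurableSet_eq : ∀ n (p : ∀ j, S j), MeasurableSet {ω | a n ω = p}
  condExp_eq : ∀ n (p : ∀ j, S j),
    μ[Set.indicator {ω | a n ω = p} (fun _ => (1 : ℝ)) | history a n] =ᵐ[μ]
      fun ω => ∏ i, σ i (perception G x₀ θ₀ (fun m => a m ω) n i) (p i)

end Game

end AdaptivePlay

end

namespace AdaptivePlay

/-! ### Limit sets of sequences -/

section StochasticApproximation

variable {E : Type*} [NormedAddCommGroup E]

/-! Since `θ_n = (n + 1) λ_n`, the process is an Euler scheme for the differential equation with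
steps `1 / (n + 2)`, perturbed by martingale noise and by a summable error (the perceptions really
move with steps `1 / (n + 1)`). The two obstacles are the denominators `λ` and the lack of
uniqueness of solutions, `σ` being only continuous.

Perceptions stay in a fixed box, on which each choice probability is at least some `δ > 0`. By
Kronecker's lemma (`tendsto_weighted_mean_zero`) the frequencies are eventually at least `δ / 2`.
Cutting the denominators off there (`cutoffField`) gives a globally continuous field and changes
neither the late process nor the field on the limit set. The noise is a finite combination, over
profiles, of `surprise` with coefficients known from the past and square-summably bounded, so its
series converges almost surely (`ae_exists_tendsto_sum_of_condExp_eq_zero`).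

The rest is deterministic (`IsPerturbedPath.isICT_limitSet`). Limits of the time-shifted path along
an ultrafilter are solutions inside the limit set (`hasDerivAt_limit`), so by contradiction every
late window of the path is uniformly shadowed by such a solution (`eventually_exists_shadow`). The
path comes near `p` and later near `q`; shadowing the successive windows in between gives a chain.
Only compactness is used, never a flow. -/

theorem mem_limitSet_iff {z : ℕ → E} {p : E} : p ∈ limitSet z ↔ MapClusterPt p atTop z := by
  constructor
  · rintro ⟨n, hn, h⟩
    exact (h.mapClusterPt).of_comp hn
  · intro h
    obtain ⟨ψ, hψ, h⟩ := h.tendsto_subseq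
    exact ⟨ψ, hψ.tendsto_atTop, h⟩

theorem isClosed_limitSet (z : ℕ → E) : IsClosed (limitSet z) := by
  have : limitSet z = {p | MapClusterPt p atTop z} := by
    ext p; exact mem_limitSet_iff
  rw [this]
  exact isClosed_setOfPred_clusterPt

theorem limitSet_subset {z : ℕ → E} {K : Set E} (hK : IsClosed K) (hz : ∀ᶠ n in atTop, z n ∈ K) :
    limitSet z ⊆ K := by
  rintro p ⟨n, hn, h⟩
  exact hK.mem_of_tendsto h (hn.eventually hz)

theorem limitSet_nonempty {z : ℕ → E} {K : Set E} (hK : IsCompact K) (hz : ∀ n, z n ∈ K) :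
    (limitSet z).Nonempty := by
  obtain ⟨p, -, ψ, hψ, h⟩ := hK.tendsto_subseq hz
  exact ⟨p, ψ, hψ.tendsto_atTop, h⟩

theorem tendsto_infDist_limitSet {z : ℕ → E} {K : Set E} (hK : IsCompact K) (hz : ∀ n, z n ∈ K) :
    Tendsto (fun n => Metric.infDist (z n) (limitSet z)) atTop (𝓝 0) := by
  refine tendsto_of_subseq_tendsto fun ns hns => ?_
  obtain ⟨p, -, ψ, hψ, h⟩ := hK.tendsto_subseq fun n => hz (ns n)
  have hp : p ∈ limitSet z := ⟨fun l => ns (ψ l), hns.comp hψ.tendsto_atTop, h⟩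
  refine ⟨ψ, ?_⟩
  have := (Metric.continuous_infDist_pt (limitSet z)).continuousAt.tendsto.comp h
  rwa [Metric.infDist_zero_of_mem hp] at this

/-! ### Perturbed Euler paths and their time scale -/

variable [NormedSpace ℝ E]

/-- The time elapsed after `n` steps of sizes `γ 0, γ 1, …`. -/
noncomputable def elapsed (γ : ℕ → ℝ) (n : ℕ) : ℝ := ∑ k ∈ Finset.range n, γ k

/-- The path `z` minus the accumulated drift of the Euler scheme with step sizes `γ`. -/
noncomputable def perturbation (F : E → E) (γ : ℕ → ℝ) (z : ℕ → E) (n : ℕ) : E :=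
  z n - ∑ k ∈ Finset.range n, γ k • F (z k)

/-- `z` is a relatively compact path of the Euler scheme for `F` with vanishing, non-summable step
sizes `γ`, perturbed by increments that form a convergent series. -/
structure IsPerturbedPath (F : E → E) (γ : ℕ → ℝ) (z : ℕ → E) : Prop where
  continuous : Continuous F
  pos : ∀ n, 0 < γ n
  tendsto_zero : Tendsto γ atTop (𝓝 0)
  tendsto_elapsed : Tendsto (elapsed γ) atTop atTop
  compact : ∃ K, IsCompact K ∧ ∀ n, z n ∈ K
  cauchySeq : CauchySeq (perturbation F γ z)

/-- `m t` is the index of the step under way at time `t`. -/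
def IsTimeIndex (γ : ℕ → ℝ) (m : ℝ → ℕ) : Prop :=
  ∀ t, 0 ≤ t → elapsed γ (m t) ≤ t ∧ t < elapsed γ (m t + 1)

theorem elapsed_succ (γ : ℕ → ℝ) (n : ℕ) : elapsed γ (n + 1) = elapsed γ n + γ n :=
  Finset.sum_range_succ _ _

namespace IsPerturbedPath

variable {F : E → E} {γ : ℕ → ℝ} {z : ℕ → E}

theorem elapsed_mono (h : IsPerturbedPath F γ z) : Monotone (elapsed γ) :=
  monotone_nat_of_le_succ fun n => by
    rw [elapsed_succ]
    exact le_add_of_nonneg_right (h.pos n).le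

theorem exists_isTimeIndex (h : IsPerturbedPath F γ z) : ∃ m, IsTimeIndex γ m := by
  classical
  have hex : ∀ t : ℝ, ∃ n, t < elapsed γ (n + 1) := fun t =>
    (((tendsto_add_atTop_iff_nat 1).2 h.tendsto_elapsed).eventually (eventually_gt_atTop t)).exists
  refine ⟨fun t => Nat.find (hex t), fun t ht => ⟨?_, Nat.find_spec (hex t)⟩⟩
  by_contra! hlt
  rcases hk : Nat.find (hex t) with _ | k
  · rw [hk] at hlt
    simp only [elapsed, Finset.range_zero, Finset.sum_empty] at hlt
    exact absurd ht (not_le.2 hlt)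
  · rw [hk] at hlt
    exact Nat.find_min (hex t) (by omega) hlt

theorem exists_drift_bound (h : IsPerturbedPath F γ z) : ∃ M, 0 ≤ M ∧ ∀ n, ‖F (z n)‖ ≤ M := by
  obtain ⟨K, hK, hz⟩ := h.compact
  obtain ⟨M, hM⟩ := hK.exists_bound_of_continuousOn h.continuous.continuousOn
  exact ⟨M, (norm_nonneg _).trans (hM _ (hz 0)), fun n => hM _ (hz n)⟩

theorem tendsto_timeIndex (h : IsPerturbedPath F γ z) {m : ℝ → ℕ} (hm : IsTimeIndex γ m) :
    Tendsto m atTop atTop := by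
  refine tendsto_atTop.2 fun N => ?_
  filter_upwards [eventually_ge_atTop 0, eventually_ge_atTop (elapsed γ N)] with t h0 hN
  by_contra! hlt
  exact absurd ((hm t h0).2.trans_le (h.elapsed_mono hlt)) (not_lt.2 hN)

theorem timeIndex_mono (h : IsPerturbedPath F γ z) {m : ℝ → ℕ} (hm : IsTimeIndex γ m) {s t : ℝ}
    (hs : 0 ≤ s) (hst : s ≤ t) : m s ≤ m t := by
  by_contra! hlt
  have h1 := (hm s hs).1
  have h2 := (hm t (hs.trans hst)).2
  have h3 := h.elapsed_mono (Nat.succ_le_of_lt hlt)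
  simp only [Nat.succ_eq_add_one] at h3
  linarith

theorem timeIndex_elapsed (h : IsPerturbedPath F γ z) {m : ℝ → ℕ} (hm : IsTimeIndex γ m) (n : ℕ) :
    m (elapsed γ n) = n := by
  have h0 : 0 ≤ elapsed γ n := Finset.sum_nonneg fun k _ => (h.pos k).le
  obtain ⟨h1, h2⟩ := hm _ h0
  refine le_antisymm ?_ ?_
  · by_contra! hlt
    have h3 := h.elapsed_mono (Nat.succ_le_of_lt hlt)
    have h4 := elapsed_succ γ n
    have h5 := h.pos n
    simp only [Nat.succ_eq_add_one] at h3
    linarith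
  · by_contra! hlt
    have h3 := h.elapsed_mono (Nat.succ_le_of_lt hlt)
    simp only [Nat.succ_eq_add_one] at h3
    linarith

/-- The step under way began less than one step size earlier and step sizes vanish, so rounding time
down to the grid costs nothing in the limit. -/
theorem tendsto_elapsed_timeIndex (h : IsPerturbedPath F γ z) {m : ℝ → ℕ} (hm : IsTimeIndex γ m)
    (s : ℝ) : Tendsto (fun t => elapsed γ (m (t + s)) - t) atTop (𝓝 s) := by
  have hs : Tendsto (fun t : ℝ => t + s) atTop atTop := tendsto_atTop_add_const_right _ _ tendsto_id
  have hγ : Tendsto (fun t => s - γ (m (t + s))) atTop (𝓝 s) := by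
    simpa using tendsto_const_nhds.sub (h.tendsto_zero.comp ((h.tendsto_timeIndex hm).comp hs))
  refine tendsto_of_tendsto_of_tendsto_of_le_of_le' hγ tendsto_const_nhds ?_ ?_
  · filter_upwards [hs.eventually (eventually_ge_atTop 0)] with t ht
    have h1 := (hm _ ht).2
    rw [elapsed_succ] at h1
    linarith
  · filter_upwards [hs.eventually (eventually_ge_atTop 0)] with t ht
    have h1 := (hm _ ht).1
    linarith

/-- Comparison with motion at constant velocity `c`: the choice `c = 0` gives Lipschitz bounds, `c =
F p` gives derivatives. -/
theorem norm_increment_sub_le (h : IsPerturbedPath F γ z) {m n : ℕ} (hmn : m ≤ n) (c : E) {ρ : ℝ}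
    (hρ : ∀ k, m ≤ k → k < n → ‖F (z k) - c‖ ≤ ρ) :
    ‖z n - z m - (elapsed γ n - elapsed γ m) • c‖ ≤
      ‖perturbation F γ z n - perturbation F γ z m‖ + ρ * (elapsed γ n - elapsed γ m) := by
  have e1 : elapsed γ n - elapsed γ m = ∑ k ∈ Finset.Ico m n, γ k :=
    (Finset.sum_Ico_eq_sub _ hmn).symm
  have e2 : z n - z m - (elapsed γ n - elapsed γ m) • c =
      (perturbation F γ z n - perturbation F γ z m) +
        ∑ k ∈ Finset.Ico m n, γ k • (F (z k) - c) := by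
    simp only [smul_sub, Finset.sum_sub_distrib, ← Finset.sum_smul, perturbation]
    rw [e1, Finset.sum_Ico_eq_sub (fun k => γ k • F (z k)) hmn]
    abel
  rw [e2, e1, Finset.mul_sum]
  refine (norm_add_le _ _).trans (add_le_add le_rfl (norm_sum_le_of_le _ fun k hk => ?_))
  rw [Finset.mem_Ico] at hk
  rw [norm_smul, Real.norm_of_nonneg (h.pos k).le, mul_comm]
  exact mul_le_mul_of_nonneg_right (hρ k hk.1 hk.2) (h.pos k).le

theorem norm_increment_le (h : IsPerturbedPath F γ z) {M : ℝ} (hM : ∀ n, ‖F (z n)‖ ≤ M)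
    {m n : ℕ} (hmn : m ≤ n) :
    ‖z n - z m‖ ≤
      ‖perturbation F γ z n - perturbation F γ z m‖ + M * (elapsed γ n - elapsed γ m) := by
  simpa using h.norm_increment_sub_le hmn 0 (ρ := M) fun k _ _ => by simpa using hM k

theorem eventually_perturbation_lt (h : IsPerturbedPath F γ z) {ε : ℝ} (hε : 0 < ε) :
    ∃ N, ∀ m ≥ N, ∀ n ≥ N, ‖perturbation F γ z n - perturbation F γ z m‖ < ε := by
  obtain ⟨N, hN⟩ := Metric.cauchySeq_iff.1 h.cauchySeq ε hε
  exact ⟨N, fun m hm n hn => by simpa [dist_eq_norm] using hN n hn m hm⟩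

theorem tendsto_perturbation_timeIndex (h : IsPerturbedPath F γ z) {m : ℝ → ℕ}
    (hm : IsTimeIndex γ m) (s s' : ℝ) :
    Tendsto (fun t => ‖perturbation F γ z (m (t + s')) - perturbation F γ z (m (t + s))‖)
      atTop (𝓝 0) := by
  rw [Metric.tendsto_nhds]
  intro ε hε
  obtain ⟨N, hN⟩ := h.eventually_perturbation_lt hε
  have hs : ∀ s : ℝ, Tendsto (fun t : ℝ => m (t + s)) atTop atTop := fun s =>
    (h.tendsto_timeIndex hm).comp (tendsto_atTop_add_const_right _ _ tendsto_id)
  filter_upwards [(hs s).eventually (eventually_ge_atTop N),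
    (hs s').eventually (eventually_ge_atTop N)] with t h1 h2
  simpa using hN _ h1 _ h2

/-! ### Limits of time-shifted paths are solutions -/

section Limit

variable {m : ℝ → ℕ} {l : Filter ℝ} [l.NeBot] {y : ℝ → E}

theorem mem_limitSet_of_tendsto (h : IsPerturbedPath F γ z) (hm : IsTimeIndex γ m)
    (hl : l ≤ atTop) (hy : ∀ s, Tendsto (fun t => z (m (t + s))) l (𝓝 (y s))) (s : ℝ) :
    y s ∈ limitSet z := by
  rw [mem_limitSet_iff]
  have hs : Tendsto (fun t : ℝ => m (t + s)) l atTop :=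
    ((h.tendsto_timeIndex hm).comp (tendsto_atTop_add_const_right _ _ tendsto_id)).mono_left hl
  exact MapClusterPt.of_comp hs (hy s).mapClusterPt

/-- The perturbation is Cauchy, so only the bounded drift survives in the limit. -/
theorem norm_limit_sub_le (h : IsPerturbedPath F γ z) (hm : IsTimeIndex γ m) (hl : l ≤ atTop)
    (hy : ∀ s, Tendsto (fun t => z (m (t + s))) l (𝓝 (y s))) {M : ℝ} (hM : ∀ n, ‖F (z n)‖ ≤ M)
    {s s' : ℝ} (hs : s ≤ s') : ‖y s' - y s‖ ≤ M * (s' - s) := by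
  have h1 : Tendsto (fun t => ‖z (m (t + s')) - z (m (t + s))‖) l (𝓝 ‖y s' - y s‖) :=
    ((hy s').sub (hy s)).norm
  have h2 : Tendsto (fun t => ‖perturbation F γ z (m (t + s')) - perturbation F γ z (m (t + s))‖ +
      M * ((elapsed γ (m (t + s')) - t) - (elapsed γ (m (t + s)) - t))) l
      (𝓝 (0 + M * (s' - s))) :=
    ((h.tendsto_perturbation_timeIndex hm s s').add (((h.tendsto_elapsed_timeIndex hm s').sub
      (h.tendsto_elapsed_timeIndex hm s)).const_mul M)).mono_left hl
  rw [zero_add] at h2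
  refine le_of_tendsto_of_tendsto h1 h2 (hl ?_)
  filter_upwards [eventually_ge_atTop (-s)] with t ht
  rw [sub_sub_sub_cancel_right]
  exact h.norm_increment_le hM (h.timeIndex_mono hm (by linarith) (by linarith))

/-- While the path stays near `p`, its drift stays near `F p`. The window may start anywhere near
`p`, which is what left-hand derivatives need. -/
theorem exists_norm_limit_sub_sub_le (h : IsPerturbedPath F γ z) (hm : IsTimeIndex γ m)
    (hl : l ≤ atTop) (hy : ∀ s, Tendsto (fun t => z (m (t + s))) l (𝓝 (y s))) (p : E) {η : ℝ}
    (hη : 0 < η) : ∃ r > 0, ∀ s s' : ℝ, s ≤ s' → s' - s < r → ‖y s - p‖ < r →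
      ‖y s' - y s - (s' - s) • F p‖ ≤ η * (s' - s) := by
  obtain ⟨M, hM0, hM⟩ := h.exists_drift_bound
  obtain ⟨δ, hδ, hF⟩ := Metric.continuousAt_iff.1 (h.continuous.continuousAt (x := p)) η hη
  -- Over a window shorter than `r`, the path starts within `r` of `p` and moves by at most `r`
  -- (noise) plus `M * r` (drift), hence stays within `(M + 2) * r < δ`.
  have hr : 0 < δ / (M + 3) := by positivity
  refine ⟨δ / (M + 3), hr, fun s s' hss hsr hp => ?_⟩
  set r := δ / (M + 3) with hrdef
  have hrδ : M * r + 3 * r = δ := by rw [hrdef]; field_simp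
  obtain ⟨N, hN⟩ := h.eventually_perturbation_lt hr
  have hE := (h.tendsto_elapsed_timeIndex hm s').sub (h.tendsto_elapsed_timeIndex hm s)
  have h1 : Tendsto (fun t => ‖z (m (t + s')) - z (m (t + s)) -
      ((elapsed γ (m (t + s')) - t) - (elapsed γ (m (t + s)) - t)) • F p‖) l
      (𝓝 ‖y s' - y s - (s' - s) • F p‖) :=
    (((hy s').sub (hy s)).sub ((hE.mono_left hl).smul_const (F p))).norm
  have h2 : Tendsto (fun t => ‖perturbation F γ z (m (t + s')) - perturbation F γ z (m (t + s))‖ +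
      η * ((elapsed γ (m (t + s')) - t) - (elapsed γ (m (t + s)) - t))) l
      (𝓝 (0 + η * (s' - s))) :=
    ((h.tendsto_perturbation_timeIndex hm s s').add (hE.const_mul η)).mono_left hl
  rw [zero_add] at h2
  refine le_of_tendsto_of_tendsto h1 h2 ?_
  have hs : Tendsto (fun t : ℝ => m (t + s)) atTop atTop :=
    (h.tendsto_timeIndex hm).comp (tendsto_atTop_add_const_right _ _ tendsto_id)
  have hnear : ∀ᶠ t in l, ‖z (m (t + s)) - p‖ < r :=
    (((hy s).sub_const p).norm).eventually (gt_mem_nhds hp)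
  filter_upwards [hl (eventually_ge_atTop (-s)), hnear, hl (hE.eventually (gt_mem_nhds hsr)),
    hl (hs.eventually (eventually_ge_atTop N))] with t ht hpt hEt hNt
  rw [sub_sub_sub_cancel_right] at hEt ⊢
  have hmn := h.timeIndex_mono hm (s := t + s) (t := t + s') (by linarith) (by linarith)
  refine h.norm_increment_sub_le hmn (F p) fun k hk hkn => ?_
  have hk1 := h.norm_increment_le hM hk
  have hk2 := hN _ hNt k (le_trans hNt hk)
  have hk3 := h.elapsed_mono hkn.le
  have hk4 : M * (elapsed γ k - elapsed γ (m (t + s))) ≤ M * r :=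
    mul_le_mul_of_nonneg_left (by linarith) hM0
  have hk5 : ‖z k - p‖ ≤ ‖z k - z (m (t + s))‖ + ‖z (m (t + s)) - p‖ := norm_sub_le_norm_sub_add_norm_sub _ _ _
  have hk6 : dist (z k) p < δ := by
    rw [dist_eq_norm]
    linarith
  have := hF hk6
  rw [dist_eq_norm] at this
  exact this.le

theorem hasDerivAt_limit (h : IsPerturbedPath F γ z) (hm : IsTimeIndex γ m) (hl : l ≤ atTop)
    (hy : ∀ s, Tendsto (fun t => z (m (t + s))) l (𝓝 (y s))) (s : ℝ) :
    HasDerivAt y (F (y s)) s := by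
  rw [hasDerivAt_iff_isLittleO, Asymptotics.isLittleO_iff]
  intro η hη
  obtain ⟨M, hM0, hM⟩ := h.exists_drift_bound
  obtain ⟨r, hr, hloc⟩ := h.exists_norm_limit_sub_sub_le hm hl hy (y s) hη
  have hr' : 0 < r / (M + 1) := by positivity
  have hrr : r / (M + 1) ≤ r := div_le_self hr.le (by linarith)
  filter_upwards [Metric.ball_mem_nhds s hr'] with s' hs'
  rw [Metric.mem_ball, Real.dist_eq] at hs'
  rcases le_total s s' with hle | hle
  · rw [abs_of_nonneg (by linarith)] at hs'
    rw [Real.norm_of_nonneg (by linarith)]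
    exact hloc s s' hle (by linarith) (by simpa using hr)
  -- To the left of `s` the window starts at `y s'`; the Lipschitz bound puts this point within `r`
  -- of `y s`.
  · rw [abs_of_nonpos (by linarith)] at hs'
    rw [Real.norm_of_nonpos (by linarith), ← norm_neg]
    have hlip := h.norm_limit_sub_le hm hl hy hM hle
    have hrM : M * (s - s') < r := by
      have h1 : (M + 1) * (s - s') < r := by
        rw [lt_div_iff₀ (by linarith)] at hs'
        linarith
      linarith
    have := hloc s' s hle (by linarith) (by rw [norm_sub_rev]; linarith)
    have e : -(y s' - y s - (s' - s) • F (y s)) = y s - y s' - (s - s') • F (y s) := by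
      rw [← neg_sub s s', neg_smul]; abel
    rwa [e, neg_sub]

end Limit

/-- One ultrafilter converges at all times `s` simultaneously, which replaces a diagonal extraction.
-/
theorem exists_ultrafilter_limit (h : IsPerturbedPath F γ z) (m : ℝ → ℕ) (u : Ultrafilter ℝ) :
    ∃ y : ℝ → E, ∀ s, Tendsto (fun t => z (m (t + s))) u (𝓝 (y s)) := by
  obtain ⟨K, hK, hz⟩ := h.compact
  have : ∀ s : ℝ, ∃ p, Tendsto (fun t => z (m (t + s))) u (𝓝 p) := fun s => by
    obtain ⟨p, -, hp⟩ := hK.ultrafilter_le_nhds (u.map fun t => z (m (t + s)))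
      (le_principal_iff.2 (Ultrafilter.mem_map.2 (Eventually.of_forall fun t => hz _)))
    exact ⟨p, hp⟩
  choose y hy using this
  exact ⟨y, hy⟩

/-- Between the points of a net of mesh `κ` both `y` and the late path move little, so convergence
at finitely many net points suffices. -/
theorem eventually_uniformly_near_limit (h : IsPerturbedPath F γ z) {m : ℝ → ℕ}
    (hm : IsTimeIndex γ m) {l : Filter ℝ} [l.NeBot] {y : ℝ → E} (hl : l ≤ atTop)
    (hy : ∀ s, Tendsto (fun t => z (m (t + s))) l (𝓝 (y s))) (T : ℝ) {ε : ℝ} (hε : 0 < ε) :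
    ∀ᶠ t in l, ∀ s ∈ Set.Icc 0 T, ‖y s - z (m (t + s))‖ < ε := by
  obtain ⟨M, hM0, hM⟩ := h.exists_drift_bound
  set κ : ℝ := ε / (4 * (M + 1)) with hκdef
  have hκ : 0 < κ := by positivity
  have hMκ : M * κ < ε / 4 := by
    rw [hκdef, mul_div_assoc', div_lt_div_iff₀ (by positivity) (by norm_num)]
    nlinarith
  -- Error budget: `ε / 4` for `y` between net points, `ε / 4` at the net point, and for the path `ε
  -- / 8` of noise, `ε / 4` of drift over `κ` and `ε / 8` of drift over one step of rounding.
  obtain ⟨N, hN⟩ := h.eventually_perturbation_lt (ε := ε / 4 / 2) (by positivity)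
  have hMγ : Tendsto (fun t => M * γ (m t)) atTop (𝓝 0) := by
    simpa using (h.tendsto_zero.comp (h.tendsto_timeIndex hm)).const_mul M
  obtain ⟨t₀, ht₀⟩ := eventually_atTop.1 (((hMγ.eventually (gt_mem_nhds
    (show (0 : ℝ) < ε / 4 / 2 by positivity))).and ((h.tendsto_timeIndex hm).eventually
    (eventually_ge_atTop N))).and (eventually_ge_atTop 0))
  have hnet : ∀ᶠ t in l, ∀ j ∈ Finset.range (⌊T / κ⌋₊ + 1),
      ‖z (m (t + j * κ)) - y (j * κ)‖ < ε / 4 :=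
    (Finset.eventually_all _).2 fun j _ => by
      have := ((hy (j * κ)).sub_const (y (j * κ))).norm
      rw [sub_self, norm_zero] at this
      exact this.eventually (gt_mem_nhds (by positivity))
  filter_upwards [hnet, hl (eventually_ge_atTop t₀)] with t ht htt s hs
  set j := ⌊s / κ⌋₊
  have hj : (j : ℝ) * κ ≤ s := (le_div_iff₀ hκ).1 (Nat.floor_le (div_nonneg hs.1 hκ.le))
  have hj' : s < (j + 1) * κ := (div_lt_iff₀ hκ).1 (Nat.lt_floor_add_one _)
  have hjT : j ∈ Finset.range (⌊T / κ⌋₊ + 1) := Finset.mem_range.2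
    (Nat.lt_succ_of_le (Nat.floor_mono (div_le_div_of_nonneg_right hs.2 hκ.le)))
  have hj0 : 0 ≤ (j : ℝ) * κ := by positivity
  obtain ⟨⟨g1, g2⟩, g3⟩ := ht₀ (t + j * κ) (by linarith)
  obtain ⟨⟨-, g4⟩, g5⟩ := ht₀ (t + s) (by linarith [hs.1])
  have b1 := ht j hjT
  have b2 := h.norm_limit_sub_le hm hl hy hM hj
  have b3 := h.norm_increment_le hM
    (h.timeIndex_mono hm (s := t + j * κ) (t := t + s) g3 (by linarith))
  have b4 := hN _ g2 _ g4
  have b5 : M * (s - j * κ) ≤ M * κ := mul_le_mul_of_nonneg_left (by linarith) hM0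
  have b6 : elapsed γ (m (t + s)) - elapsed γ (m (t + j * κ)) ≤ κ + γ (m (t + j * κ)) := by
    have c1 := (hm _ g5).1
    have c2 := (hm _ g3).2
    rw [elapsed_succ] at c2
    linarith
  have b7 := mul_le_mul_of_nonneg_left b6 hM0
  rw [mul_add] at b7
  have b8 : ‖y s - z (m (t + s))‖ ≤ ‖y s - y (j * κ)‖ + ‖z (m (t + j * κ)) - y (j * κ)‖ +
      ‖z (m (t + s)) - z (m (t + j * κ))‖ := by
    have : y s - z (m (t + s)) = (y s - y (j * κ)) - (z (m (t + j * κ)) - y (j * κ))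
      - (z (m (t + s)) - z (m (t + j * κ))) := by abel
    rw [this]
    exact (norm_sub_le _ _).trans (add_le_add (norm_sub_le _ _) le_rfl)
  linarith

/-- Otherwise some ultrafilter at infinity is concentrated on the bad times; the limit along it is a
solution that shadows the path at one of them. -/
theorem eventually_exists_shadow (h : IsPerturbedPath F γ z) {m : ℝ → ℕ} (hm : IsTimeIndex γ m)
    (T : ℝ) {ε : ℝ} (hε : 0 < ε) : ∀ᶠ t in atTop, ∃ y : ℝ → E, IsSolutionOn F T y ∧
      ∀ s ∈ Set.Icc 0 T, y s ∈ limitSet z ∧ ‖y s - z (m (t + s))‖ < ε := by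
  by_contra hcon
  obtain ⟨u, hu'⟩ := exists_ultrafilter_iff.2 (frequently_iff_neBot.1 (not_eventually.1 hcon))
  have hu := le_inf_iff.1 hu'
  obtain ⟨y, hy⟩ := h.exists_ultrafilter_limit m u
  obtain ⟨t, ht, ht'⟩ := ((h.eventually_uniformly_near_limit hm hu.1 hy T hε).and (le_principal_iff.1 hu.2)).exists
  exact ht' ⟨y, fun s _ => (h.hasDerivAt_limit hm hu.1 hy s).hasDerivWithinAt,
    fun s hs => ⟨h.mem_limitSet_of_tendsto hm hu.1 hy s, ht s hs⟩⟩

end IsPerturbedPath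

/-! ### Chain transitivity of the limit set -/

theorem IsSolutionOn.mono {F : E → E} {T T' : ℝ} {y : ℝ → E} (hy : IsSolutionOn F T y)
    (h : T' ≤ T) : IsSolutionOn F T' y := fun s hs =>
  (hy s ⟨hs.1, hs.2.trans h⟩).mono (Set.Icc_subset_Icc_right h)

/-- The limit set of a perturbed Euler path is internally chain transitive. -/
theorem IsPerturbedPath.isICT_limitSet {F : E → E} {γ : ℕ → ℝ} {z : ℕ → E}
    (h : IsPerturbedPath F γ z) : IsICT F (limitSet z) := by
  obtain ⟨K, hK, hz⟩ := h.compact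
  refine ⟨hK.of_isClosed_subset (isClosed_limitSet z)
    (limitSet_subset hK.isClosed (Eventually.of_forall hz)), fun ε hε T hT p hp q hq => ?_⟩
  obtain ⟨m, hm⟩ := h.exists_isTimeIndex
  obtain ⟨t₀, ht₀⟩ := eventually_atTop.1
    (h.eventually_exists_shadow hm (2 * (T + 1)) (half_pos hε))
  have hvisit : ∀ p ∈ limitSet z, ∀ t : ℝ, ∃ t' ≥ t, ‖z (m t') - p‖ < ε / 2 := by
    rintro p ⟨n, hn, hnp⟩ t
    have h1 := (hnp.sub_const p).norm
    rw [sub_self, norm_zero] at h1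
    obtain ⟨l, hl1, hl2⟩ := ((h1.eventually (gt_mem_nhds (half_pos hε))).and
      ((h.tendsto_elapsed.comp hn).eventually (eventually_ge_atTop t))).exists
    exact ⟨elapsed γ (n l), hl2, by rwa [h.timeIndex_elapsed hm]⟩
  obtain ⟨t, ht, htp⟩ := hvisit p hp t₀
  obtain ⟨t', ht', htq⟩ := hvisit q hq (t + (T + 1))
  -- The interval from `t` to `t'` is cut into `N` equal pieces, of length `d` between `T + 1` and
  -- `2 * (T + 1)`: longer than `T`, yet covered by the shadows.
  set N := ⌊(t' - t) / (T + 1)⌋₊ with hN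
  have hN1 : 1 ≤ N := Nat.le_floor (by
    rw [Nat.cast_one, le_div_iff₀ (by linarith)]; linarith)
  have hN1' : (1 : ℝ) ≤ N := by exact_mod_cast hN1
  set d := (t' - t) / N with hd
  have hNd : N * d = t' - t := by rw [hd]; field_simp
  have hd1 : T + 1 ≤ d := by
    have h1 : (N : ℝ) * (T + 1) ≤ t' - t := (le_div_iff₀ (by linarith)).1
      (Nat.floor_le (div_nonneg (by linarith) (by linarith)))
    rw [hd, le_div_iff₀ (by linarith)]
    linarith
  have hd2 : d ≤ 2 * (T + 1) := by
    have h1 : t' - t < (N + 1) * (T + 1) := (div_lt_iff₀ (by linarith)).1 (Nat.lt_floor_add_one _)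
    rw [hd, div_le_iff₀ (by linarith)]
    nlinarith
  have hshadow : ∀ j : ℕ, ∃ y : ℝ → E, IsSolutionOn F (2 * (T + 1)) y ∧
      ∀ s ∈ Set.Icc 0 (2 * (T + 1)), y s ∈ limitSet z ∧ ‖y s - z (m (t + j * d + s))‖ < ε / 2 :=
    fun j => ht₀ _ (by
      have : 0 ≤ (j : ℝ) * d := mul_nonneg (Nat.cast_nonneg _) (by linarith)
      linarith)
  choose c hc1 hc2 using hshadow
  have hd0 : d ∈ Set.Icc 0 (2 * (T + 1)) := ⟨by linarith, hd2⟩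
  have h00 : (0 : ℝ) ∈ Set.Icc 0 (2 * (T + 1)) := ⟨le_rfl, by linarith⟩
  -- Index `k` in `HasChain` means `k + 1` links, hence `N - 1`. At a junction both solutions are
  -- within `ε / 2` of the same point of the path.
  refine ⟨N - 1, c, fun _ => d, fun j _ => ⟨by linarith, (hc1 j).mono hd2, fun s hs =>
    (hc2 j s ⟨hs.1, hs.2.trans hd2⟩).1⟩, fun j _ => ?_, ?_, ?_⟩
  · have e1 := (hc2 j d hd0).2
    have e2 := (hc2 (j + 1) 0 h00).2
    have e3 : t + ((j + 1 : ℕ) : ℝ) * d + 0 = t + j * d + d := by push_cast; ring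
    rw [e3, norm_sub_rev] at e2
    exact (norm_sub_le_norm_sub_add_norm_sub _ _ _).trans_lt
      ((add_lt_add e1 e2).trans_eq (add_halves ε))
  · have e1 := (hc2 0 0 h00).2
    simp only [Nat.cast_zero, zero_mul, add_zero] at e1
    exact (norm_sub_le_norm_sub_add_norm_sub _ _ _).trans_lt
      ((add_lt_add e1 htp).trans_eq (add_halves ε))
  · have e1 := (hc2 (N - 1) d hd0).2
    have e3 : t + ((N - 1 : ℕ) : ℝ) * d + d = t' := by
      rw [Nat.cast_sub hN1, Nat.cast_one]; linarith
    rw [e3] at e1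
    exact (norm_sub_le_norm_sub_add_norm_sub _ _ _).trans_lt
      ((add_lt_add e1 htq).trans_eq (add_halves ε))

/-- The solutions of a chain run inside `D`, so the field matters only there. -/
theorem IsICT.congr {F H : E → E} {D : Set E} (h : IsICT F D) (hFH : ∀ p ∈ D, F p = H p) :
    IsICT H D := by
  refine ⟨h.1, fun ε hε T hT p hp q hq => ?_⟩
  obtain ⟨k, c, t, h1, h2⟩ := h.2 ε hε T hT p hp q hq
  refine ⟨k, c, t, fun j hj => ⟨(h1 j hj).1, fun s hs => ?_, (h1 j hj).2.2⟩, h2⟩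
  rw [← hFH _ ((h1 j hj).2.2 s hs)]
  exact (h1 j hj).2.1 s hs

end StochasticApproximation

end AdaptivePlay

namespace AdaptivePlay

set_option linter.unusedSectionVars false

/-! ### Almost sure convergence of martingale series -/

section MartingaleSeries

variable {Ω : Type*} {mΩ : MeasurableSpace Ω} {μ : Measure Ω} [IsProbabilityMeasure μ]

/-- A series of bounded martingale differences whose bounds are square-summable converges almost
surely. -/
theorem ae_exists_tendsto_sum_of_condExp_eq_zero (ℱ : Filtration ℕ mΩ) {d : ℕ → Ω → ℝ} {b : ℕ → ℝ}
    (hd : ∀ n, StronglyMeasurable[ℱ (n + 1)] (d n)) (hdb : ∀ n ω, |d n ω| ≤ b n)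
    (hcond : ∀ n, μ[d n | ℱ n] =ᵐ[μ] 0) (hb : Summable fun n => b n ^ 2) :
    ∀ᵐ ω ∂μ, ∃ c, Tendsto (fun n => ∑ k ∈ Finset.range n, d k ω) atTop (𝓝 c) := by
  set M : ℕ → Ω → ℝ := fun n ω => ∑ k ∈ Finset.range n, d k ω with hM
  have hM_succ : ∀ n, M (n + 1) = M n + d n := fun n => by
    ext ω; exact Finset.sum_range_succ _ _
  have hMm : StronglyAdapted ℱ M := fun n =>
    Finset.stronglyMeasurable_fun_sum _ fun k hk =>
      (hd k).mono (ℱ.mono (Finset.mem_range.1 hk))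
  have hMb : ∀ n ω, |M n ω| ≤ ∑ k ∈ Finset.range n, b k := fun n ω =>
    (Finset.abs_sum_le_sum_abs _ _).trans (Finset.sum_le_sum fun k _ => hdb k ω)
  have hint : ∀ {f : Ω → ℝ} (C : ℝ), StronglyMeasurable f → (∀ ω, |f ω| ≤ C) → Integrable f μ :=
    fun C hf hC => Integrable.of_bound hf.aestronglyMeasurable C (Eventually.of_forall hC)
  have hMm' : ∀ n, StronglyMeasurable (M n) := fun n => (hMm n).mono (ℱ.le n)
  have hdm' : ∀ n, StronglyMeasurable (d n) := fun n => (hd n).mono (ℱ.le _)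
  have hMi : ∀ n, Integrable (M n) μ := fun n => hint _ (hMm' n) (hMb n)
  have hdi : ∀ n, Integrable (d n) μ := fun n => hint _ (hdm' n) (hdb n)
  have hmart : Martingale M ℱ μ := martingale_of_condExp_sub_eq_zero_nat hMm hMi fun n => by
    rw [hM_succ, add_sub_cancel_left]
    exact hcond n
  have hMd : ∀ n, Integrable (M n * d n) μ := fun n =>
    (hdi n).bdd_mul (hMm' n).aestronglyMeasurable (Eventually.of_forall (hMb n))
  have hM2 : ∀ n, Integrable (fun ω => M n ω ^ 2) μ := fun n =>
    hint ((∑ k ∈ Finset.range n, b k) ^ 2) ((hMm' n).pow 2) fun ω => by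
      rw [abs_pow]
      exact pow_le_pow_left₀ (abs_nonneg _) (hMb n ω) 2
  have hd2 : ∀ n, Integrable (fun ω => d n ω ^ 2) μ := fun n =>
    hint (b n ^ 2) ((hdm' n).pow 2) fun ω => by
      rw [abs_pow]
      exact pow_le_pow_left₀ (abs_nonneg _) (hdb n ω) 2
  have hcross : ∀ n, ∫ ω, M n ω * d n ω ∂μ = 0 := fun n => by
    have h1 : μ[M n * d n | ℱ n] =ᵐ[μ] 0 := by
      filter_upwards [condExp_mul_of_stronglyMeasurable_left (hMm n) (hMd n) (hdi n), hcond n]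
        with ω h1 h2
      rw [h1, Pi.mul_apply, h2, Pi.zero_apply, mul_zero]
    calc ∫ ω, M n ω * d n ω ∂μ = ∫ ω, (μ[M n * d n | ℱ n]) ω ∂μ :=
          (integral_condExp (ℱ.le n)).symm
      _ = 0 := by rw [integral_congr_ae h1]; simp
  have hsq : ∀ n, ∫ ω, M n ω ^ 2 ∂μ ≤ ∑ k ∈ Finset.range n, b k ^ 2 := fun n => by
    induction n with
    | zero => simp [hM]
    | succ n ih =>
      have e : ∀ ω, M (n + 1) ω ^ 2 = M n ω ^ 2 + 2 * (M n ω * d n ω) + d n ω ^ 2 := fun ω => by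
        rw [hM_succ, Pi.add_apply]; ring
      have h2 : ∫ ω, d n ω ^ 2 ∂μ ≤ b n ^ 2 := by
        refine (integral_mono (hd2 n) (integrable_const (b n ^ 2)) fun ω => ?_).trans_eq (by simp)
        exact sq_le_sq' (neg_le_of_abs_le (hdb n ω)) (le_of_abs_le (hdb n ω))
      have hMd2 : Integrable (fun ω => 2 * (M n ω * d n ω)) μ := (hMd n).const_mul 2
      have hadd : Integrable (fun ω => M n ω ^ 2 + 2 * (M n ω * d n ω)) μ := (hM2 n).add hMd2
      simp_rw [e]
      rw [integral_add hadd (hd2 n), integral_add (hM2 n) hMd2, integral_const_mul, hcross,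
        Finset.sum_range_succ]
      linarith
  -- The inequality `|x| ≤ 1 + x ^ 2` turns the second-moment bound into the `L¹` bound required by
  -- Doob's convergence theorem.
  have hL1 : ∀ n, eLpNorm (M n) 1 μ ≤ ((1 + ∑' k, b k ^ 2).toNNReal : ENNReal) := fun n => by
    rw [eLpNorm_one_eq_lintegral_enorm, ← ofReal_integral_norm_eq_lintegral_enorm (hMi n)]
    refine ENNReal.ofReal_le_ofReal ?_
    calc ∫ ω, ‖M n ω‖ ∂μ ≤ ∫ ω, (1 + M n ω ^ 2) ∂μ :=
          integral_mono (hMi n).norm ((integrable_const 1).add (hM2 n)) fun ω => by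
            simp only [Real.norm_eq_abs]
            nlinarith [sq_abs (M n ω), sq_nonneg (|M n ω| - 1)]
      _ = 1 + ∫ ω, M n ω ^ 2 ∂μ := by rw [integral_add (integrable_const 1) (hM2 n)]; simp
      _ ≤ 1 + ∑' k, b k ^ 2 := by
          have := hb.sum_le_tsum (Finset.range n) fun k _ => sq_nonneg (b k)
          linarith [hsq n]
  exact hmart.submartingale.exists_ae_tendsto_of_bdd hL1

end MartingaleSeries

/-! ### The noise of play -/

section Game

variable {ι : Type*} [Fintype ι] [DecidableEq ι]
  {S : ι → Type*} [∀ i, Fintype (S i)] [∀ i, DecidableEq (S i)]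

/-- The probability that the profile `p` is played in stage `n + 1`, given the first `n` stages
of `h`. -/
noncomputable def playProb (G : ι → (∀ j, S j) → ℝ) (σ : ∀ i, (S i → ℝ) → (S i → ℝ))
    (x₀ θ₀ : ∀ i, S i → ℝ) (h : ℕ → ∀ j, S j) (n : ℕ) (p : ∀ j, S j) : ℝ :=
  ∏ i, σ i (perception G x₀ θ₀ h n i) (p i)

/-- The deviation of the profile played in stage `n + 1` from its conditional law. -/
noncomputable def surprise (G : ι → (∀ j, S j) → ℝ) (σ : ∀ i, (S i → ℝ) → (S i → ℝ))
    (x₀ θ₀ : ∀ i, S i → ℝ) (h : ℕ → ∀ j, S j) (n : ℕ) (p : ∀ j, S j) : ℝ :=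
  (if h n = p then 1 else 0) - playProb G σ x₀ θ₀ h n p

/-- `φ h` depends only on the first `n` stages of `h`. -/
def DependsOnPast {β : Type*} (n : ℕ) (φ : (ℕ → ∀ j, S j) → β) : Prop :=
  ∀ h h' : ℕ → ∀ j, S j, (∀ m < n, h m = h' m) → φ h = φ h'

theorem dependsOnPast_count (θ₀ : ∀ i, S i → ℝ) (n : ℕ) :
    DependsOnPast n fun h => count θ₀ h n := fun h h' hh => by
  ext i s
  simp only [count]
  congr 3
  exact Finset.filter_congr fun m hm => by rw [hh m (Finset.mem_range.1 hm)]

theorem dependsOnPast_perception (G : ι → (∀ j, S j) → ℝ) (x₀ θ₀ : ∀ i, S i → ℝ) (n : ℕ) :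
    DependsOnPast n fun h => perception G x₀ θ₀ h n := fun h h' hh => by
  induction n with
  | zero => rfl
  | succ n ih =>
    have h1 := ih fun m hm => hh m (hm.trans n.lt_succ_self)
    have h2 := dependsOnPast_count θ₀ n h h' fun m hm => hh m (hm.trans n.lt_succ_self)
    simp only at h1 h2
    ext i s
    simp only [perception, h1, h2, hh n n.lt_succ_self]

theorem dependsOnPast_playProb (G : ι → (∀ j, S j) → ℝ) (σ : ∀ i, (S i → ℝ) → (S i → ℝ))
    (x₀ θ₀ : ∀ i, S i → ℝ) (n : ℕ) (p : ∀ j, S j) :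
    DependsOnPast n fun h => playProb G σ x₀ θ₀ h n p := fun h h' hh => by
  have := dependsOnPast_perception G x₀ θ₀ n h h' hh
  simp only at this
  simp only [playProb, this]

/-- There are finitely many beginnings of length `n`, so the preimage of any set is a finite union
of cylinders. -/
theorem measurable_history {Ω : Type*} (a : ℕ → Ω → ∀ j, S j) {n : ℕ}
    {φ : (ℕ → ∀ j, S j) → ℝ} (hφ : DependsOnPast n φ) :
    Measurable[history a n] fun ω => φ fun m => a m ω := by
  intro B _
  have e : (fun ω => φ fun m => a m ω) ⁻¹' B =
      ⋃ q ∈ {q : Fin n → ∀ j, S j | ∃ h, (∀ m : Fin n, h m = q m) ∧ φ h ∈ B},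
        ⋂ m : Fin n, {ω | a m ω = q m} := by
    ext ω
    simp only [Set.mem_preimage, Set.mem_iUnion, Set.mem_iInter, Set.mem_ofPred_eq, exists_prop]
    constructor
    · exact fun hω => ⟨fun m => a m ω, ⟨fun m => a m ω, fun _ => rfl, hω⟩, fun _ => rfl⟩
    · rintro ⟨q, ⟨h, hq, hB⟩, hω⟩
      rwa [hφ (fun m => a m ω) h fun m hm => (hω ⟨m, hm⟩).trans (hq ⟨m, hm⟩).symm]
  rw [e]
  refine MeasurableSet.biUnion (Set.to_countable _) fun q _ => MeasurableSet.iInter fun m => ?_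
  have hle : MeasurableSpace.comap (a m) ⊤ ≤ history a n :=
    le_iSup₂ (f := fun m (_ : m < n) => MeasurableSpace.comap (a m) ⊤) (m : ℕ) m.2
  exact hle _ ⟨{q m}, trivial, rfl⟩

theorem abs_surprise_le (G : ι → (∀ j, S j) → ℝ) {σ : ∀ i, (S i → ℝ) → (S i → ℝ)}
    (hσ : ∀ i x, σ i x ∈ stdSimplex ℝ (S i)) (x₀ θ₀ : ∀ i, S i → ℝ) (h : ℕ → ∀ j, S j) (n : ℕ)
    (p : ∀ j, S j) : |surprise G σ x₀ θ₀ h n p| ≤ 1 := by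
  have h0 : 0 ≤ playProb G σ x₀ θ₀ h n p := Finset.prod_nonneg fun i _ => (hσ i _).1 _
  have h1 : playProb G σ x₀ θ₀ h n p ≤ 1 := Finset.prod_le_one (fun i _ => (hσ i _).1 _)
    fun i _ => (Finset.single_le_sum (fun s _ => (hσ i _).1 s) (Finset.mem_univ _)).trans_eq
      (hσ i _).2
  rw [surprise, abs_le]
  split_ifs <;> constructor <;> linarith

variable {Ω : Type*} [mΩ : MeasurableSpace Ω] {μ : Measure Ω} {G : ι → (∀ j, S j) → ℝ}
  {σ : ∀ i, (S i → ℝ) → (S i → ℝ)} {x₀ θ₀ : ∀ i, S i → ℝ} {a : ℕ → Ω → ∀ j, S j}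

/-- The filtration generated by the play. -/
def IsPlay.filtration (ha : IsPlay μ G σ x₀ θ₀ a) : Filtration ℕ mΩ where
  seq := history a
  mono' := fun _ _ hmn => iSup₂_mono' fun k hk => ⟨k, hk.trans_le hmn, le_rfl⟩
  le' := fun n => iSup₂_le fun m _ => by
    rintro _ ⟨A, -, rfl⟩
    have e : a m ⁻¹' A = ⋃ p ∈ A, {ω | a m ω = p} := by ext; simp
    rw [e]
    exact MeasurableSet.biUnion (Set.to_countable _) fun p _ => ha.measurableSet_eq m p

/-- Given the past, the `surprise` of a fixed profile has mean zero, also after multiplication by a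
weight known from the past. The noise in both `x` and `λ` is a sum of such terms over profiles. -/
theorem IsPlay.ae_exists_tendsto_sum_surprise [IsProbabilityMeasure μ]
    (ha : IsPlay μ G σ x₀ θ₀ a) (hσ : ∀ i x, σ i x ∈ stdSimplex ℝ (S i)) (p : ∀ j, S j)
    {v : ℕ → (ℕ → ∀ j, S j) → ℝ} {b : ℕ → ℝ} (hv : ∀ n, DependsOnPast n (v n))
    (hvb : ∀ n h, |v n h| ≤ b n) (hb : Summable fun n => b n ^ 2) :
    ∀ᵐ ω ∂μ, ∃ c, Tendsto (fun n => ∑ k ∈ Finset.range n,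
      v k (fun m => a m ω) * surprise G σ x₀ θ₀ (fun m => a m ω) k p) atTop (𝓝 c) := by
  have hbound : ∀ n h, |v n h * surprise G σ x₀ θ₀ h n p| ≤ b n := fun n h => by
    rw [abs_mul]
    exact (mul_le_of_le_one_right (abs_nonneg _) (abs_surprise_le G hσ x₀ θ₀ h n p)).trans
      (hvb n h)
  have hdep : ∀ n, DependsOnPast (n + 1) fun h => surprise G σ x₀ θ₀ h n p := fun n h h' hh => by
    have := dependsOnPast_playProb G σ x₀ θ₀ n p h h' fun m hm => hh m (hm.trans n.lt_succ_self)
    simp only at this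
    simp only [surprise, this, hh n n.lt_succ_self]
  have hvm : ∀ n, StronglyMeasurable[history a n] fun ω => v n fun m => a m ω := fun n =>
    (measurable_history a (hv n)).stronglyMeasurable
  have hsm : ∀ n, StronglyMeasurable[history a (n + 1)]
      fun ω => surprise G σ x₀ θ₀ (fun m => a m ω) n p := fun n =>
    (measurable_history a (hdep n)).stronglyMeasurable
  have hle : ∀ n, history a n ≤ mΩ := ha.filtration.le
  refine ae_exists_tendsto_sum_of_condExp_eq_zero ha.filtration
    (fun n => ((hvm n).mono (ha.filtration.mono n.le_succ)).mul (hsm n))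
    (fun n ω => hbound n _) (fun n => ?_) hb
  have hsi : Integrable (fun ω => surprise G σ x₀ θ₀ (fun m => a m ω) n p) μ :=
    Integrable.of_bound ((hsm n).mono (hle _)).aestronglyMeasurable 1
      (Eventually.of_forall fun ω => abs_surprise_le G hσ x₀ θ₀ _ n p)
  have hvsi : Integrable ((fun ω => v n fun m => a m ω) *
      fun ω => surprise G σ x₀ θ₀ (fun m => a m ω) n p) μ :=
    hsi.bdd_mul ((hvm n).mono (hle n)).aestronglyMeasurable
      (Eventually.of_forall fun ω => hvb n _)
  have hind : Integrable (Set.indicator {ω | a n ω = p} fun _ => (1 : ℝ)) μ :=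
    (integrable_const 1).indicator (ha.measurableSet_eq n p)
  have hpm : StronglyMeasurable[history a n]
      fun ω => playProb G σ x₀ θ₀ (fun m => a m ω) n p :=
    (measurable_history a (dependsOnPast_playProb G σ x₀ θ₀ n p)).stronglyMeasurable
  have e : (fun ω => surprise G σ x₀ θ₀ (fun m => a m ω) n p) =
      Set.indicator {ω | a n ω = p} (fun _ => (1 : ℝ)) -
        fun ω => playProb G σ x₀ θ₀ (fun m => a m ω) n p := by
    ext ω
    simp [surprise, Set.indicator]
  have hpi : Integrable (fun ω => playProb G σ x₀ θ₀ (fun m => a m ω) n p) μ := by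
    have := hind.sub hsi
    rwa [e, sub_sub_cancel] at this
  have hs0 : μ[fun ω => surprise G σ x₀ θ₀ (fun m => a m ω) n p | history a n] =ᵐ[μ] 0 := by
    rw [e]
    refine (condExp_sub hind hpi _).trans ?_
    rw [condExp_of_stronglyMeasurable (hle n) hpm hpi]
    filter_upwards [ha.condExp_eq n p] with ω hω
    rw [Pi.sub_apply, hω]
    simp [playProb]
  filter_upwards [condExp_mul_of_stronglyMeasurable_left (hvm n) hvsi hsi, hs0] with ω h1 h2
  refine h1.trans ?_
  rw [Pi.mul_apply, h2, Pi.zero_apply, mul_zero]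

end Game

end AdaptivePlay

/-! ### Kronecker's lemma and the process as a perturbed Euler path -/

namespace AdaptivePlay

set_option linter.unusedSectionVars false

/-- Kronecker's lemma: summation by parts reduces the mean to `M n` minus nearly its Cesàro mean,
and both tend to `c`. -/
theorem tendsto_weighted_mean_zero {M d : ℕ → ℝ} {c : ℝ} (hM : Tendsto M atTop (𝓝 c))
    (h0 : M 0 = 0) (hd : ∀ k : ℕ, M (k + 1) - M k = 1 / ((k : ℝ) + 2) * d k) :
    Tendsto (fun n : ℕ => (∑ k ∈ Finset.range n, d k) / ((n : ℝ) + 1)) atTop (𝓝 0) := by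
  have e : ∀ n : ℕ, ∑ k ∈ Finset.range n, d k = (n + 1) * M n - ∑ k ∈ Finset.range n, M k := by
    intro n
    induction n with
    | zero => simp [h0]
    | succ n ih =>
      have h2 : (n : ℝ) + 2 ≠ 0 := by positivity
      have h3 : d n = (n + 2) * (M (n + 1) - M n) := by rw [hd]; field_simp
      rw [Finset.sum_range_succ, Finset.sum_range_succ, ih, h3]
      push_cast
      ring
  have h1 := hM.cesaro
  have h2 : Tendsto (fun n : ℕ => M n - ((n : ℝ) / (n + 1)) *
      ((n : ℝ)⁻¹ * ∑ k ∈ Finset.range n, M k)) atTop (𝓝 (c - 1 * c)) :=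
    hM.sub (tendsto_natCast_div_add_atTop (1 : ℝ) |>.mul h1)
  rw [one_mul, sub_self] at h2
  refine h2.congr' ?_
  filter_upwards [eventually_ge_atTop 1] with n hn
  have hn' : (n : ℝ) ≠ 0 := by positivity
  have hn1 : (n : ℝ) + 1 ≠ 0 := by positivity
  rw [e]
  field_simp

section Game

variable {ι : Type*} [Fintype ι] [DecidableEq ι]
  {S : ι → Type*} [∀ i, Fintype (S i)] [∀ i, DecidableEq (S i)]

theorem count_succ (θ₀ : ∀ i, S i → ℝ) (h : ℕ → ∀ j, S j) (n : ℕ) (i : ι) (s : S i) :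
    count θ₀ h (n + 1) i s = count θ₀ h n i s + if h n i = s then 1 else 0 := by
  simp only [count, Finset.range_add_one, Finset.filter_insert]
  split_ifs with hs
  · rw [Finset.card_insert_of_notMem (by simp)]
    push_cast
    ring
  · simp

theorem count_eq_sum (θ₀ : ∀ i, S i → ℝ) (h : ℕ → ∀ j, S j) (n : ℕ) (i : ι) (s : S i) :
    count θ₀ h n i s = θ₀ i s + ∑ k ∈ Finset.range n, if h k i = s then 1 else 0 := by
  simp [count]

theorem le_count (θ₀ : ∀ i, S i → ℝ) (h : ℕ → ∀ j, S j) (n : ℕ) (i : ι) (s : S i) :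
    θ₀ i s ≤ count θ₀ h n i s := le_add_of_nonneg_right (Nat.cast_nonneg _)

theorem count_le (θ₀ : ∀ i, S i → ℝ) (h : ℕ → ∀ j, S j) (n : ℕ) (i : ι) (s : S i) :
    count θ₀ h n i s ≤ θ₀ i s + n := by
  have := (Finset.card_filter_le (Finset.range n) fun m => h m i = s)
  rw [Finset.card_range] at this
  exact add_le_add le_rfl (by exact_mod_cast this)

theorem sum_count (θ₀ : ∀ i, S i → ℝ) (h : ℕ → ∀ j, S j) (n : ℕ) (i : ι) :
    ∑ s, count θ₀ h n i s = ∑ s, θ₀ i s + n := by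
  simp only [count_eq_sum, Finset.sum_add_distrib]
  rw [Finset.sum_comm]
  simp

theorem perception_succ (G : ι → (∀ j, S j) → ℝ) (x₀ θ₀ : ∀ i, S i → ℝ) (h : ℕ → ∀ j, S j)
    (n : ℕ) (i : ι) (s : S i) :
    perception G x₀ θ₀ h (n + 1) i s = perception G x₀ θ₀ h n i s +
      1 / count θ₀ h n i s * (if h n i = s then G i (h n) - perception G x₀ θ₀ h n i s else 0) := by
  simp only [perception]
  split_ifs <;> ring

/-- Once `s` has been played the count is at least `1` and every update is a convex combination.
Only the first update can overshoot, when `θ₀ i s < 1`; the factor `1 + 1 / θ₀ i s` pays for it. -/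
theorem abs_perception_le {G : ι → (∀ j, S j) → ℝ} {Γ : ℝ} (hG : ∀ i p, |G i p| ≤ Γ)
    (x₀ : ∀ i, S i → ℝ) {θ₀ : ∀ i, S i → ℝ} (hθ₀ : ∀ i s, 0 < θ₀ i s) (h : ℕ → ∀ j, S j)
    (n : ℕ) (i : ι) (s : S i) :
    |perception G x₀ θ₀ h n i s| ≤ (1 + 1 / θ₀ i s) * (|x₀ i s| + Γ) := by
  set R := (1 + 1 / θ₀ i s) * (|x₀ i s| + Γ) with hR
  have hΓ : 0 ≤ Γ := (abs_nonneg _).trans (hG i (h 0))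
  have hθ : 0 < 1 / θ₀ i s := one_div_pos.2 (hθ₀ i s)
  have hx0 := abs_nonneg (x₀ i s)
  have hR1 : |x₀ i s| + Γ ≤ R := le_mul_of_one_le_left (by positivity) (by linarith)
  -- The invariant separates the stages after the first use of `s` from those before it, when
  -- nothing has moved.
  suffices H : |perception G x₀ θ₀ h n i s| ≤ R ∧ (1 ≤ count θ₀ h n i s ∨
      perception G x₀ θ₀ h n i s = x₀ i s ∧ count θ₀ h n i s = θ₀ i s) from H.1
  induction n with
  | zero => exact ⟨by simp only [perception]; linarith, Or.inr ⟨rfl, by simp [count]⟩⟩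
  | succ n ih =>
    rw [count_succ]
    simp only [perception]
    split_ifs with hs
    · have hc := le_count θ₀ h n i s
      have hc0 := (hθ₀ i s).trans_le hc
      refine ⟨?_, Or.inl (by linarith)⟩
      rcases ih.2 with h1 | ⟨h1, h2⟩
      · have hle : 1 / count θ₀ h n i s ≤ 1 := (div_le_one hc0).2 h1
        have hpos : 0 < 1 / count θ₀ h n i s := one_div_pos.2 hc0
        refine (abs_add_le _ _).trans ?_
        rw [abs_mul, abs_mul, abs_of_nonneg (by linarith : 0 ≤ 1 - 1 / count θ₀ h n i s),
          abs_of_pos hpos]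
        have e1 := mul_le_mul_of_nonneg_left ih.1 (by linarith : 0 ≤ 1 - 1 / count θ₀ h n i s)
        have e2 := mul_le_mul_of_nonneg_left ((hG i (h n)).trans (by linarith : Γ ≤ R)) hpos.le
        linarith
      · rw [h1, h2]
        refine (abs_add_le _ _).trans ?_
        rw [abs_mul, abs_mul, abs_of_pos hθ]
        have e0 : |1 - 1 / θ₀ i s| ≤ 1 + 1 / θ₀ i s := abs_le.2 ⟨by linarith, by linarith⟩
        have e1 := mul_le_mul_of_nonneg_right e0 hx0
        have e2 := mul_le_mul (by linarith : 1 / θ₀ i s ≤ 1 + 1 / θ₀ i s) (hG i (h n))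
          (abs_nonneg _) (by linarith)
        rw [hR, mul_add]
        linarith
    · simpa using ih

theorem mul_prod_update_single (π : ∀ j, S j → ℝ) (i : ι) (s : S i) (p : ∀ j, S j) :
    π i s * ∏ j, Function.update π i (Pi.single s 1) j (p j) =
      if p i = s then ∏ j, π j (p j) else 0 := by
  rw [← Finset.mul_prod_erase _ _ (Finset.mem_univ i), Function.update_self]
  split_ifs with hs
  · rw [← Finset.mul_prod_erase Finset.univ (fun j => π j (p j)) (Finset.mem_univ i), hs,
      Pi.single_eq_same, one_mul]
    congr 1
    exact Finset.prod_congr rfl fun j hj => by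
      rw [Function.update_of_ne (Finset.ne_of_mem_erase hj)]
  · rw [Pi.single_eq_of_ne hs, zero_mul, mul_zero]

/-- The expected payoff of `i` on the event that `i` draws `s`, which is how the drift of `x`
arises. -/
theorem mul_deviationPayoff (G : ι → (∀ j, S j) → ℝ) (π : ∀ j, S j → ℝ) (i : ι) (s : S i) :
    π i s * deviationPayoff G i s π =
      ∑ p : ∀ j, S j, if p i = s then (∏ j, π j (p j)) * G i p else 0 := by
  rw [deviationPayoff, mixedPayoff, Finset.mul_sum]
  refine Finset.sum_congr rfl fun p _ => ?_
  rw [← mul_assoc, mul_prod_update_single, ite_mul, zero_mul]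

/-- Replacing the law of player `i` by a point mass at `s` leaves a product law of total mass one.
-/
theorem sum_prod_marginal {π : ∀ j, S j → ℝ} (hπ : ∀ j, ∑ s, π j s = 1) (i : ι) (s : S i) :
    ∑ p : ∀ j, S j, (if p i = s then ∏ j, π j (p j) else 0) = π i s := by
  have h1 : ∑ p : ∀ j, S j, ∏ j, Function.update π i (Pi.single s 1) j (p j) = 1 := by
    rw [← Fintype.piFinset_univ, ← Finset.prod_univ_sum]
    refine Finset.prod_eq_one fun j _ => ?_
    rcases eq_or_ne j i with rfl | hj
    · simp
    · simp [Function.update_of_ne hj, hπ]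
  simp_rw [← mul_prod_update_single, ← Finset.mul_sum, h1, mul_one]

/-- The vector field of the continuous dynamics, with the frequencies in the denominators cut off
from below at `c`. -/
noncomputable def cutoffField (G : ι → (∀ j, S j) → ℝ) (σ : ∀ i, (S i → ℝ) → (S i → ℝ))
    (c : ∀ i, S i → ℝ) (z : (∀ i, S i → ℝ) × (∀ i, S i → ℝ)) :
    (∀ i, S i → ℝ) × (∀ i, S i → ℝ) :=
  (fun i s => σ i (z.1 i) s / max (z.2 i s) (c i s)
      * (deviationPayoff G i s (fun j => σ j (z.1 j)) - z.1 i s),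
   fun i s => σ i (z.1 i) s - z.2 i s)

theorem cutoffField_eq_vectorField (G : ι → (∀ j, S j) → ℝ)
    (σ : ∀ i, (S i → ℝ) → (S i → ℝ)) {c : ∀ i, S i → ℝ}
    {z : (∀ i, S i → ℝ) × (∀ i, S i → ℝ)} (hz : ∀ i s, c i s ≤ z.2 i s) :
    cutoffField G σ c z = vectorField G σ z := by
  simp only [cutoffField, vectorField, max_eq_left (hz _ _)]

theorem continuous_deviationPayoff (G : ι → (∀ j, S j) → ℝ) (i : ι) (s : S i) :
    Continuous fun π : ∀ j, S j → ℝ => deviationPayoff G i s π := by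
  have h : Continuous fun π : ∀ j, S j → ℝ => Function.update π i (Pi.single s 1) :=
    continuous_id.update i continuous_const
  simp only [deviationPayoff, mixedPayoff]
  exact continuous_finsetSum _ fun p _ => (continuous_finsetProd _ fun j _ =>
    (continuous_apply (p j)).comp ((continuous_apply j).comp h)).mul continuous_const

theorem continuous_cutoffField (G : ι → (∀ j, S j) → ℝ) {σ : ∀ i, (S i → ℝ) → (S i → ℝ)}
    (hσ : ∀ i, Continuous (σ i)) {c : ∀ i, S i → ℝ} (hc : ∀ i s, 0 < c i s) :
    Continuous (cutoffField G σ c) := by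
  have h1 : ∀ i s, Continuous fun z : (∀ i, S i → ℝ) × (∀ i, S i → ℝ) => z.1 i s := fun i s =>
    (continuous_apply s).comp ((continuous_apply i).comp continuous_fst)
  have h2 : ∀ i s, Continuous fun z : (∀ i, S i → ℝ) × (∀ i, S i → ℝ) => z.2 i s := fun i s =>
    (continuous_apply s).comp ((continuous_apply i).comp continuous_snd)
  have hs : ∀ i, Continuous fun z : (∀ i, S i → ℝ) × (∀ i, S i → ℝ) => σ i (z.1 i) := fun i =>
    (hσ i).comp ((continuous_apply i).comp continuous_fst)
  have hss : ∀ i s, Continuous fun z : (∀ i, S i → ℝ) × (∀ i, S i → ℝ) => σ i (z.1 i) s :=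
    fun i s => (continuous_apply s).comp (hs i)
  refine Continuous.prodMk (continuous_pi fun i => continuous_pi fun s => ?_)
    (continuous_pi fun i => continuous_pi fun s => (hss i s).sub (h2 i s))
  refine ((hss i s).div ((h2 i s).max continuous_const) fun z =>
    ((hc i s).trans_le (le_max_right _ _)).ne').mul (Continuous.sub ?_ (h1 i s))
  exact (continuous_deviationPayoff G i s).comp (continuous_pi hs)

variable {G : ι → (∀ j, S j) → ℝ} {σ : ∀ i, (S i → ℝ) → (S i → ℝ)} {x₀ θ₀ : ∀ i, S i → ℝ}
  {h : ℕ → ∀ j, S j}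

/-- This reduces the noise in any function of the next profile to the surprises of single profiles.
-/
theorem sum_mul_surprise (v : (∀ j, S j) → ℝ) (n : ℕ) :
    ∑ p, v p * surprise G σ x₀ θ₀ h n p = v (h n) - ∑ p, v p * playProb G σ x₀ θ₀ h n p := by
  simp only [surprise, mul_sub, Finset.sum_sub_distrib, mul_ite, mul_one, mul_zero,
    Finset.sum_ite_eq, Finset.mem_univ, if_true]

theorem sum_indicator_surprise (hσ : ∀ i x, σ i x ∈ stdSimplex ℝ (S i)) (n : ℕ) (i : ι)
    (s : S i) :
    ∑ p : ∀ j, S j, (if p i = s then 1 else 0) * surprise G σ x₀ θ₀ h n p =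
      (if h n i = s then 1 else 0) - σ i (perception G x₀ θ₀ h n i) s := by
  rw [sum_mul_surprise, ← sum_prod_marginal (π := fun j => σ j (perception G x₀ θ₀ h n j))
    (fun j => (hσ j _).2) i s]
  simp only [ite_mul, one_mul, zero_mul, playProb]

theorem sum_payoff_surprise (hσ : ∀ i x, σ i x ∈ stdSimplex ℝ (S i)) (n : ℕ) (i : ι)
    (s : S i) (x : ℝ) :
    ∑ p : ∀ j, S j, (if p i = s then G i p - x else 0) * surprise G σ x₀ θ₀ h n p =
      (if h n i = s then G i (h n) - x else 0) - σ i (perception G x₀ θ₀ h n i) s *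
        (deviationPayoff G i s (fun j => σ j (perception G x₀ θ₀ h n j)) - x) := by
  have e1 := mul_deviationPayoff G (fun j => σ j (perception G x₀ θ₀ h n j)) i s
  have e2 := sum_prod_marginal (π := fun j => σ j (perception G x₀ θ₀ h n j))
    (fun j => (hσ j _).2) i s
  rw [sum_mul_surprise, mul_sub, e1, ← e2, Finset.sum_mul, ← Finset.sum_sub_distrib]
  congr 1
  refine Finset.sum_congr rfl fun p _ => ?_
  rw [playProb]
  split_ifs <;> ring

theorem frequency_succ_sub (n : ℕ) (i : ι) (s : S i) :
    frequency θ₀ h (n + 1) i s - frequency θ₀ h n i s =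
      1 / ((n : ℝ) + 2) * ((if h n i = s then 1 else 0) - frequency θ₀ h n i s) := by
  have h1 : (n : ℝ) + 1 ≠ 0 := by positivity
  have h2 : (n : ℝ) + 2 ≠ 0 := by positivity
  have h3 : (n : ℝ) + 1 + 1 = n + 2 := by ring
  simp only [frequency, count_succ]
  push_cast
  rw [h3]
  field_simp
  ring

/-- The strategies are drawn with frequencies that are eventually bounded away from zero. -/
theorem eventually_le_frequency (hσ : ∀ i x, σ i x ∈ stdSimplex ℝ (S i)) {i : ι} {s : S i}
    (hθ : 0 < θ₀ i s) {δ : ℝ} (hδ : 0 < δ)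
    (hσδ : ∀ n, δ ≤ σ i (perception G x₀ θ₀ h n i) s)
    (hconv : ∃ c, Tendsto (fun n => ∑ k ∈ Finset.range n, ∑ p : ∀ j, S j,
      1 / ((k : ℝ) + 2) * (if p i = s then 1 else 0) * surprise G σ x₀ θ₀ h k p) atTop (𝓝 c)) :
    ∀ᶠ n in atTop, δ / 2 ≤ frequency θ₀ h n i s := by
  obtain ⟨c, hc⟩ := hconv
  -- The number of uses of `s` minus the sum of its conditional probabilities is `o(n)`, and each of
  -- these probabilities is at least `δ`.
  have h1 := tendsto_weighted_mean_zero hc (by simp)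
    (d := fun k => (if h k i = s then 1 else 0) - σ i (perception G x₀ θ₀ h k i) s) fun k => by
      rw [Finset.sum_range_succ, add_sub_cancel_left]
      simp only [mul_assoc]
      rw [← Finset.mul_sum, sum_indicator_surprise hσ]
  have h2 := h1.add ((tendsto_natCast_div_add_atTop (1 : ℝ)).const_mul δ)
  rw [zero_add, mul_one] at h2
  filter_upwards [h2.eventually (lt_mem_nhds (half_lt_self hδ))] with n hn
  refine hn.le.trans ?_
  rw [frequency, count_eq_sum, mul_div_assoc', ← add_div]
  refine div_le_div_of_nonneg_right ?_ (by positivity)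
  have h3 : ∑ k ∈ Finset.range n, δ ≤
      ∑ k ∈ Finset.range n, σ i (perception G x₀ θ₀ h k i) s :=
    Finset.sum_le_sum fun k _ => hσδ k
  rw [Finset.sum_const, Finset.card_range, nsmul_eq_mul] at h3
  rw [Finset.sum_sub_distrib]
  linarith

theorem summable_one_div_sq_shift : Summable fun n : ℕ => 1 / ((n : ℝ) + 1) ^ 2 := by
  have := (summable_nat_add_iff 1).2 (Real.summable_one_div_nat_pow.2 (by norm_num : 1 < 2))
  simpa using this

/-- If the two noise series converge and the frequencies stay away from zero, then the process is a
perturbed Euler path of the continuous dynamics. -/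
theorem isPerturbedPath_process (hσ : ∀ i x, σ i x ∈ stdSimplex ℝ (S i))
    (hσ_cont : ∀ i, Continuous (σ i)) {c : ∀ i, S i → ℝ}
    (hc : ∀ i s, 0 < c i s) {K : Set ((∀ i, S i → ℝ) × (∀ i, S i → ℝ))} (hK : IsCompact K)
    (hzK : ∀ n, process G x₀ θ₀ h n ∈ K)
    (hfreq : ∀ i s, ∀ᶠ n in atTop, c i s ≤ frequency θ₀ h n i s)
    (hconv₁ : ∀ i s, ∃ l, Tendsto (fun n => ∑ k ∈ Finset.range n, ∑ p : ∀ j, S j,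
      1 / ((k : ℝ) + 2) * (if p i = s then 1 else 0) * surprise G σ x₀ θ₀ h k p) atTop (𝓝 l))
    (hconv₂ : ∀ i s, ∃ l, Tendsto (fun n => ∑ k ∈ Finset.range n, ∑ p : ∀ j, S j,
      1 / max (count θ₀ h k i s) (c i s * ((k : ℝ) + 1)) *
        (if p i = s then G i p - perception G x₀ θ₀ h k i s else 0) *
        surprise G σ x₀ θ₀ h k p) atTop (𝓝 l)) :
    IsPerturbedPath (cutoffField G σ c) (fun n : ℕ => 1 / ((n : ℝ) + 2))
      (process G x₀ θ₀ h) := by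
  have hcont := continuous_cutoffField G hσ_cont hc
  refine ⟨hcont, fun n => by positivity, ?_, ?_, ⟨K, hK, hzK⟩, ?_⟩
  · have := (tendsto_add_atTop_iff_nat 1).2 (tendsto_one_div_add_atTop_nhds_zero_nat (𝕜 := ℝ))
    refine this.congr fun n => ?_
    push_cast
    ring
  · have hdiv : ¬ Summable fun n : ℕ => 1 / ((n : ℝ) + 2) := fun hs =>
      Real.not_summable_one_div_natCast ((summable_nat_add_iff 2).1 (by simpa using hs))
    exact (not_summable_iff_tendsto_nat_atTop_of_nonneg fun n => by positivity).1 hdiv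
  · obtain ⟨B, hB⟩ := hK.exists_bound_of_continuousOn hcont.continuousOn
    have hfst : ∀ i s, ∃ l, Tendsto (fun n => (perturbation (cutoffField G σ c)
        (fun n : ℕ => 1 / ((n : ℝ) + 2)) (process G x₀ θ₀ h) n).1 i s) atTop (𝓝 l) := by
      intro i s
      obtain ⟨l, hl⟩ := hconv₂ i s
      set N : ℕ → ℝ := fun n => ∑ k ∈ Finset.range n, ∑ p : ∀ j, S j,
        1 / max (count θ₀ h k i s) (c i s * ((k : ℝ) + 1)) *
          (if p i = s then G i p - perception G x₀ θ₀ h k i s else 0) *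
          surprise G σ x₀ θ₀ h k p with hN
      set W : ℕ → ℝ := fun n => (perturbation (cutoffField G σ c)
        (fun n : ℕ => 1 / ((n : ℝ) + 2)) (process G x₀ θ₀ h) n).1 i s with hW
      have hWe : ∀ n, W n = perception G x₀ θ₀ h n i s - ∑ k ∈ Finset.range n,
          1 / ((k : ℝ) + 2) * (cutoffField G σ c (process G x₀ θ₀ h k)).1 i s := fun n => by
        simp [hW, perturbation, process, Prod.fst_sum]
      -- With the noise `N` removed, what remains comes from the step `1 / (n + 1)` in `x` against
      -- the nominal `1 / (n + 2)`: a summable multiple of a bounded drift, as soon as the cutoff is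
      -- inactive.
      have hcauchy : CauchySeq fun n => W n - N n := by
        refine cauchySeq_of_summable_dist (Summable.of_norm_bounded_eventually_nat
          (summable_one_div_sq_shift.mul_left B) ?_)
        filter_upwards [hfreq i s] with n hn
        have hn1 : (0 : ℝ) < n + 1 := by positivity
        have hC : count θ₀ h n i s = frequency θ₀ h n i s * (n + 1) := by
          rw [frequency, div_mul_cancel₀ _ hn1.ne']
        have hf0 : frequency θ₀ h n i s ≠ 0 := ((hc i s).trans_le hn).ne'
        have hmax : max (count θ₀ h n i s) (c i s * ((n : ℝ) + 1)) = count θ₀ h n i s :=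
          max_eq_left (by rw [hC]; exact mul_le_mul_of_nonneg_right hn hn1.le)
        have e : W (n + 1) - N (n + 1) - (W n - N n) = (1 / ((n : ℝ) + 1) - 1 / (n + 2)) *
            (cutoffField G σ c (process G x₀ θ₀ h n)).1 i s := by
          rw [hWe, hWe, hN]
          simp only [Finset.sum_range_succ, mul_assoc]
          rw [← Finset.mul_sum, sum_payoff_surprise hσ, perception_succ, hmax, hC]
          simp only [cutoffField, process, max_eq_left hn]
          field_simp
          ring
        have hb : |(cutoffField G σ c (process G x₀ θ₀ h n)).1 i s| ≤ B :=
          (norm_le_pi_norm _ s).trans ((norm_le_pi_norm _ i).trans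
            ((norm_fst_le _).trans (hB _ (hzK n))))
        have hg : |1 / ((n : ℝ) + 1) - 1 / (n + 2)| ≤ 1 / ((n : ℝ) + 1) ^ 2 := by
          have : 1 / ((n : ℝ) + 1) - 1 / (n + 2) = 1 / ((n + 1) * (n + 2)) := by
            field_simp
            ring
          rw [this, abs_of_pos (by positivity)]
          exact one_div_le_one_div_of_le (by positivity) (by nlinarith)
        rw [Real.norm_of_nonneg dist_nonneg, dist_comm, Real.dist_eq, Nat.succ_eq_add_one, e,
          abs_mul, mul_comm]
        exact mul_le_mul hb hg (abs_nonneg _) ((abs_nonneg _).trans hb)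
      obtain ⟨l', hl'⟩ := cauchySeq_tendsto_of_complete hcauchy
      exact ⟨l' + l, (hl'.add hl).congr fun n => by ring⟩
    have hsnd : ∀ i s, ∃ l, Tendsto (fun n => (perturbation (cutoffField G σ c)
        (fun n : ℕ => 1 / ((n : ℝ) + 2)) (process G x₀ θ₀ h) n).2 i s) atTop (𝓝 l) := by
      intro i s
      obtain ⟨l, hl⟩ := hconv₁ i s
      -- For `λ` the step is exactly `1 / (n + 2)`, so the perturbation is the initial value plus
      -- the noise.
      refine ⟨frequency θ₀ h 0 i s + l, (hl.const_add _).congr fun n => ?_⟩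
      have e : (perturbation (cutoffField G σ c) (fun n : ℕ => 1 / ((n : ℝ) + 2))
          (process G x₀ θ₀ h) n).2 i s = frequency θ₀ h n i s - ∑ k ∈ Finset.range n,
          1 / ((k : ℝ) + 2) * (σ i (perception G x₀ θ₀ h k i) s - frequency θ₀ h k i s) := by
        simp [perturbation, process, Prod.snd_sum, cutoffField]
      have e' : frequency θ₀ h n i s = frequency θ₀ h 0 i s + ∑ k ∈ Finset.range n,
          (frequency θ₀ h (k + 1) i s - frequency θ₀ h k i s) := by
        rw [Finset.sum_range_sub (fun n => frequency θ₀ h n i s)]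
        ring
      rw [e, e', add_sub_assoc, ← Finset.sum_sub_distrib]
      congr 1
      refine Finset.sum_congr rfl fun k _ => ?_
      simp only [mul_assoc]
      rw [← Finset.mul_sum, sum_indicator_surprise hσ, frequency_succ_sub]
      ring
    choose l₁ hl₁ using hfst
    choose l₂ hl₂ using hsnd
    exact Tendsto.cauchySeq (x := (l₁, l₂)) (Tendsto.prodMk_nhds
      (tendsto_pi_nhds.2 fun i => tendsto_pi_nhds.2 fun s => hl₁ i s)
      (tendsto_pi_nhds.2 fun i => tendsto_pi_nhds.2 fun s => hl₂ i s))

end Game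

end AdaptivePlay

/-! ### The limit theorem -/

open AdaptivePlay

theorem mainTheorem3
    {ι : Type*} [Fintype ι] [DecidableEq ι]
    {S : ι → Type*} [∀ i, Fintype (S i)] [∀ i, DecidableEq (S i)]
    (G : ι → (∀ j, S j) → ℝ)
    (σ : ∀ i, (S i → ℝ) → (S i → ℝ))
    (hσ_simplex : ∀ i x, σ i x ∈ stdSimplex ℝ (S i))
    (hσ_cont : ∀ i, Continuous (σ i))
    (hσ_pos : ∀ i x s, 0 < σ i x s)
    (x₀ θ₀ : ∀ i, S i → ℝ) (hθ₀ : ∀ i s, 0 < θ₀ i s)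
    {Ω : Type*} [MeasurableSpace Ω] (μ : Measure Ω) [IsProbabilityMeasure μ]
    (a : ℕ → Ω → ∀ j, S j)
    (ha : AdaptivePlay.IsPlay μ G σ x₀ θ₀ a) :
    ∀ᵐ ω ∂μ,
      let z : ℕ → (∀ i, S i → ℝ) × (∀ i, S i → ℝ) :=
        AdaptivePlay.process G x₀ θ₀ (fun m => a m ω)
      let L := AdaptivePlay.limitSet z
      L.Nonempty ∧ L ⊆ AdaptivePlay.phaseSpace S ∧
        AdaptivePlay.IsICT (AdaptivePlay.vectorField G σ) L ∧
        Tendsto (fun n => Metric.infDist (z n) L) atTop (𝓝 0) := by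
  obtain ⟨Γ, hΓ⟩ : ∃ Γ, ∀ i p, |G i p| ≤ Γ := by
    obtain ⟨Γ, hΓ⟩ := (Set.finite_range fun q : ι × (∀ j, S j) => |G q.1 q.2|).bddAbove
    exact ⟨Γ, fun i p => hΓ ⟨(i, p), rfl⟩⟩
  set R : ∀ i, S i → ℝ := fun i s => (1 + 1 / θ₀ i s) * (|x₀ i s| + Γ) with hR
  have hx : ∀ h n i s, |perception G x₀ θ₀ h n i s| ≤ R i s :=
    fun h n i s => abs_perception_le hΓ x₀ hθ₀ h n i s
  have hx_mem : ∀ h n i, perception G x₀ θ₀ h n i ∈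
      Set.pi Set.univ fun s => Set.Icc (-R i s) (R i s) := fun h n i s _ => abs_le.1 (hx h n i s)
  have hcompact : ∀ i, IsCompact (Set.pi Set.univ fun s => Set.Icc (-R i s) (R i s)) :=
    fun i => isCompact_univ_pi fun s => isCompact_Icc
  -- The continuous positive `σ` attains its minimum on the compact box of perceptions, so `δ` is
  -- the same for all plays.
  have hδ : ∀ i s, ∃ δ > 0, ∀ h n, δ ≤ σ i (perception G x₀ θ₀ h n i) s := by
    intro i s
    by_cases hne : Nonempty (ℕ → ∀ j, S j)
    · obtain ⟨h₀⟩ := hne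
      obtain ⟨x, -, hmin⟩ := (hcompact i).exists_isMinOn ⟨_, hx_mem h₀ 0 i⟩
        ((continuous_apply s).comp (hσ_cont i)).continuousOn
      exact ⟨σ i x s, hσ_pos i x s, fun h n => hmin (hx_mem h n i)⟩
    · exact ⟨1, one_pos, fun h => absurd ⟨h⟩ hne⟩
  choose δ hδ0 hδ using hδ
  set c : ∀ i, S i → ℝ := fun i s => δ i s / 2 with hc
  have hc0 : ∀ i s, 0 < c i s := fun i s => half_pos (hδ0 i s)
  have hnoise₁ : ∀ᵐ ω ∂μ, ∀ i, ∀ s : S i, ∀ p : ∀ j, S j, ∃ l,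
      Tendsto (fun n => ∑ k ∈ Finset.range n, 1 / ((k : ℝ) + 2) * (if p i = s then 1 else 0) *
        surprise G σ x₀ θ₀ (fun m => a m ω) k p) atTop (𝓝 l) := by
    refine ae_all_iff.2 fun i => ae_all_iff.2 fun s => ae_all_iff.2 fun p => ?_
    refine ha.ae_exists_tendsto_sum_surprise hσ_simplex p
      (v := fun k _ => 1 / ((k : ℝ) + 2) * (if p i = s then 1 else 0))
      (b := fun k => 1 / ((k : ℝ) + 1)) (fun n h h' _ => rfl) (fun n h => ?_)
      (by simpa using summable_one_div_sq_shift)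
    have h1 : 1 / ((n : ℝ) + 2) ≤ 1 / (n + 1) :=
      one_div_le_one_div_of_le (by positivity) (by linarith)
    have h2 : 0 < 1 / ((n : ℝ) + 2) := by positivity
    rw [abs_mul, abs_of_pos h2]
    split_ifs <;> simp only [abs_one, abs_zero, mul_one, mul_zero] <;> linarith
  have hnoise₂ : ∀ᵐ ω ∂μ, ∀ i, ∀ s : S i, ∀ p : ∀ j, S j, ∃ l,
      Tendsto (fun n => ∑ k ∈ Finset.range n,
        1 / max (count θ₀ (fun m => a m ω) k i s) (c i s * ((k : ℝ) + 1)) *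
          (if p i = s then G i p - perception G x₀ θ₀ (fun m => a m ω) k i s else 0) *
        surprise G σ x₀ θ₀ (fun m => a m ω) k p) atTop (𝓝 l) := by
    refine ae_all_iff.2 fun i => ae_all_iff.2 fun s => ae_all_iff.2 fun p => ?_
    -- The cutoff `c i s * (k + 1)` makes the weights `O(1 / k)` for every play. Without it they
    -- would be small only eventually, at a random time.
    refine ha.ae_exists_tendsto_sum_surprise hσ_simplex p
      (v := fun k h => 1 / max (count θ₀ h k i s) (c i s * ((k : ℝ) + 1)) *
          (if p i = s then G i p - perception G x₀ θ₀ h k i s else 0))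
      (b := fun k => (Γ + R i s) / c i s * (1 / ((k : ℝ) + 1))) (fun n h h' hh => ?_)
      (fun n h => ?_) ?_
    · have e1 := dependsOnPast_count θ₀ n h h' hh
      have e2 := dependsOnPast_perception G x₀ θ₀ n h h' hh
      simp only at e1 e2
      simp only [e1, e2]
    · have hn : 0 < c i s * ((n : ℝ) + 1) := mul_pos (hc0 i s) (by positivity)
      have h1 : 1 / max (count θ₀ h n i s) (c i s * ((n : ℝ) + 1)) ≤
          1 / (c i s * ((n : ℝ) + 1)) := one_div_le_one_div_of_le hn (le_max_right _ _)
      have h2 : 0 < 1 / max (count θ₀ h n i s) (c i s * ((n : ℝ) + 1)) :=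
        one_div_pos.2 (hn.trans_le (le_max_right _ _))
      have h3 : |if p i = s then G i p - perception G x₀ θ₀ h n i s else 0| ≤ Γ + R i s := by
        split_ifs
        · exact (abs_sub _ _).trans (add_le_add (hΓ i p) (hx h n i s))
        · rw [abs_zero]
          exact add_nonneg ((abs_nonneg _).trans (hΓ i p)) ((abs_nonneg _).trans (hx h n i s))
      rw [abs_mul, abs_of_pos h2]
      refine (mul_le_mul h1 h3 (abs_nonneg _) (by positivity)).trans_eq ?_
      have := (hc0 i s).ne'
      field_simp
    · refine (summable_one_div_sq_shift.mul_left (((Γ + R i s) / c i s) ^ 2)).congr fun n => ?_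
      rw [mul_pow, one_div_pow]
  filter_upwards [hnoise₁, hnoise₂] with ω hω₁ hω₂
  intro z L
  set h : ℕ → ∀ j, S j := fun m => a m ω with hh
  have hswap : ∀ f : ℕ → (∀ j, S j) → ℝ,
      (∀ p, ∃ l, Tendsto (fun n => ∑ k ∈ Finset.range n, f k p) atTop (𝓝 l)) →
      ∃ l, Tendsto (fun n => ∑ k ∈ Finset.range n, ∑ p, f k p) atTop (𝓝 l) := by
    intro f hf
    choose l hl using hf
    refine ⟨∑ p, l p, (tendsto_finsetSum _ fun p _ => hl p).congr fun n => Finset.sum_comm⟩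
  have hfreq : ∀ i s, ∀ᶠ n in atTop, c i s ≤ frequency θ₀ h n i s := fun i s =>
    eventually_le_frequency hσ_simplex (hθ₀ i s) (hδ0 i s) (fun n => hδ i s h n)
      (hswap _ (hω₁ i s))
  set K : Set ((∀ i, S i → ℝ) × (∀ i, S i → ℝ)) :=
    (Set.pi Set.univ fun i => Set.pi Set.univ fun s => Set.Icc (-R i s) (R i s)) ×ˢ
      (Set.pi Set.univ fun i => Set.pi Set.univ fun s => Set.Icc 0 (θ₀ i s + 1)) with hKdef
  have hK : IsCompact K := (isCompact_univ_pi hcompact).prod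
    (isCompact_univ_pi fun i => isCompact_univ_pi fun s => isCompact_Icc)
  have hzK : ∀ n, z n ∈ K := by
    refine fun n => ⟨fun i _ => hx_mem h n i, fun i _ s _ => ⟨?_, ?_⟩⟩
    · exact div_nonneg ((hθ₀ i s).le.trans (le_count θ₀ h n i s)) (by positivity)
    · refine (div_le_iff₀ (by positivity)).2 ((count_le θ₀ h n i s).trans ?_)
      have := mul_nonneg (hθ₀ i s).le (Nat.cast_nonneg (α := ℝ) n)
      linarith
  have hpath := isPerturbedPath_process hσ_simplex hσ_cont hc0 hK hzK hfreq
    (fun i s => hswap _ (hω₁ i s)) (fun i s => hswap _ (hω₂ i s))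
  -- The eventual lower bound on frequencies is a closed condition, so it passes to `L`, where the
  -- cutoff field is therefore the true one.
  have hLc : ∀ q ∈ L, ∀ i s, c i s ≤ q.2 i s := fun q hq i s =>
    limitSet_subset (K := {q : (∀ i, S i → ℝ) × (∀ i, S i → ℝ) | c i s ≤ q.2 i s})
      (isClosed_le continuous_const ((continuous_apply s).comp
        ((continuous_apply i).comp continuous_snd))) (hfreq i s) hq
  refine ⟨limitSet_nonempty hK hzK, fun q hq i => ⟨⟨fun s => ?_, ?_⟩, fun s => ?_⟩,
    hpath.isICT_limitSet.congr fun q hq => cutoffField_eq_vectorField G σ (hLc q hq),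
    tendsto_infDist_limitSet hK hzK⟩
  · exact (hc0 i s).le.trans (hLc q hq i s)
  · obtain ⟨n, hn, hnq⟩ := hq
    have h1 : Tendsto (fun l => ∑ s, (z (n l)).2 i s) atTop (𝓝 (∑ s, q.2 i s)) :=
      tendsto_finsetSum _ fun s _ => ((hnq.snd_nhds.apply_nhds i).apply_nhds s)
    -- The `λ_n` need not lie in the simplex: their weights sum to `(∑ s, θ₀ i s + n) / (n + 1)`,
    -- which equals one only in the limit in general.
    have h2 : Tendsto (fun n => ∑ s, (z n).2 i s) atTop (𝓝 1) := by
      have h3 := ((tendsto_one_div_add_atTop_nhds_zero_nat (𝕜 := ℝ)).const_mul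
        (∑ s, θ₀ i s)).add (tendsto_natCast_div_add_atTop (1 : ℝ))
      rw [mul_zero, zero_add] at h3
      refine h3.congr fun n => ?_
      have e : ∑ s, (z n).2 i s = (∑ s, count θ₀ h n i s) / ((n : ℝ) + 1) := by
        rw [Finset.sum_div]; rfl
      rw [e, sum_count]
      ring
    exact tendsto_nhds_unique h1 (h2.comp hn)
  · exact (hc0 i s).trans_le (hLc q hq i s)
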